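/- Let $\mathcal P,\mathcal H,\mathcal M,\mathcal Q$ be real Hilbert spaces such that $\mathcal P\hookrightarrow\mathcal H\cong\mathcal H^*\hookrightarrow\mathcal P^*$ is a Gelfand triple ($\mathcal P$ is continuously and densely embedded in $\mathcal H$, and $\mathcal H$ is identified with its dual by the Riesz isomorphism), and identify $\mathcal M$ with $\mathcal M^*$ by its Riesz isomorphism. Let $$\mathcal A:\mathcal H\to\mathcal H^*,\qquad \mathcal K:\mathcal P\to\mathcal M^*,\qquad \mathcal D:\mathcal M\to\mathcal M^*,\qquad \mathcal B:\mathcal P\to\mathcal Q^*$$ be bounded linear operators, and put $\mathcal P_{\ker}:=\ker\mathcal B\subseteq\mathcal P$ and $\mathcal H_{\ker}:=\overline{\mathcal P_{\ker}}^{\,\mathcal H}$. Assume that there are constants $c_{\mathcal D},\beta,c_{\mathcal K}>0$ such that $$c_{\mathcal D}\|m\|_{\mathcal M}^2\le\langle\mathcal D m,m\rangle\quad (m\in\mathcal M),\qquad \sup_{q\in\mathcal P\setminus\{0\}}\frac{\langle\mathcal B q,\mu\rangle}{\|q\|_{\mathcal P}\|\mu\|_{\mathcal Q}}\ge\beta\quad(\mu\in\mathcal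 Q\setminus\{0\}),\qquad c_{\mathcal K}\|q\|_{\mathcal P}\le\|\mathcal K q\|_{\mathcal M^*}\quad(q\in\mathcal P_{\ker}).$$ Let $\varepsilon>0$, $T>0$, and let $f\in H^1(0,T;\mathcal M^*)$, $g=g_1+g_2$ with $g_1\in H^2(0,T;\mathcal P^*)$ and $g_2\in H^1(0,T;\mathcal H^*)$, and $h\in H^2(0,T;\mathcal Q^*)$, where each of these functions is identified with its continuous representative on $[0,T]$. Let $p^0\in\mathcal P$ and $m^0\in\mathcal M$ be initial data such that $\mathcal B p^0=h(0)$ and such that there exists $\mathfrak h\in\mathcal H_{\ker}$ with $$(\mathfrak h,q)_{\mathcal H}=\langle\mathcal K^*m^0+g_1(0),q\rangle\qquad\text{for all } q\in\mathcal P_{\ker}.$$ Call $(p,m,\lambda):[0,T]\to\mathcal P\times\mathcal M\times\mathcal Q$ a classical solution if $p$ is differentiable on $[0,T]$ as a function with values in $\mathcal H$, $m$ is differentiable on $[0,T]$ with values in $\mathcal M$ (one-sided derivatives at the end points), $p(0)=p^0$, $m(0)=m^0$, and for every $t\in[0,T]$ $$\begin{aligned}\dot p(t)+\mathcal A p(t)-\mathcal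 K^*m(t)+\mathcal B^*\lambda(t)&=g(t)&&\text{in }\mathcal P^*,\\ \varepsilon\,\dot m(t)+\mathcal K p(t)+\mathcal D m(t)&=f(t)&&\text{in }\mathcal M^*,\\ \mathcal B p(t)&=h(t)&&\text{in }\mathcal Q^*.\end{aligned}$$ Then there exists a unique classical solution $(p,m,\lambda)$, and it satisfies $$p\in C([0,T],\mathcal P)\cap C^1([0,T],\mathcal H),\qquad m\in C^1([0,T],\mathcal M),\qquad \lambda\in C([0,T],\mathcal Q).$$ -/

import Mathlib

open MeasureTheory Set
open scoped ContDiff InnerProductSpace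

namespace HyperbolicPDAE

section Bochner

variable {X : Type*} [NormedAddCommGroup X] [NormedSpace ℝ X]

/-- The function `v` is a weak (distributional) derivative of `u` on the interval `(0, T)`. -/
def IsWeakDeriv (T : ℝ) (u v : ℝ → X) : Prop :=
  ∀ φ : ℝ → ℝ, ContDiff ℝ ∞ φ → HasCompactSupport φ → tsupport φ ⊆ Ioo 0 T →
    ∫ t in Ioo 0 T, deriv φ t • u t = -∫ t in Ioo 0 T, φ t • v t

/-- `u` belongs to the Sobolev-Bochner space `H^k(0, T; X)`: it is square Bochner integrable on
`(0, T)`, and so are its weak derivatives up to the order `k`. -/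
def MemSobolevBochner (T : ℝ) : ℕ → (ℝ → X) → Prop
  | 0, u => MemLp u 2 (volume.restrict (Ioo 0 T))
  | k + 1, u => MemLp u 2 (volume.restrict (Ioo 0 T)) ∧
      ∃ v : ℝ → X, IsWeakDeriv T u v ∧ MemSobolevBochner T k v

/-- `u` is the continuous representative on `[0, T]` of an element of `H^k(0, T; X)`.
For `k ≥ 1` every element of `H^k(0, T; X)` has exactly one such representative, and the point
values of the element are those of the representative. -/
def IsSobolevRepresentative (T : ℝ) (k : ℕ) (u : ℝ → X) : Prop :=
  ContinuousOn u (Icc 0 T) ∧ MemSobolevBochner T k u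

end Bochner

section Operators

variable {P H M Q : Type*}
  [NormedAddCommGroup P] [InnerProductSpace ℝ P] [CompleteSpace P]
  [NormedAddCommGroup H] [InnerProductSpace ℝ H] [CompleteSpace H]
  [NormedAddCommGroup M] [InnerProductSpace ℝ M] [CompleteSpace M]
  [NormedAddCommGroup Q] [InnerProductSpace ℝ Q] [CompleteSpace Q]

/-- Ellipticity of `D : M → M^*`. -/
def IsElliptic (D : M →L[ℝ] StrongDual ℝ M) : Prop :=
  ∃ c : ℝ, 0 < c ∧ ∀ m : M, c * ‖m‖ ^ 2 ≤ D m m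

/-- Inf-sup stability of `B : P → Q^*`:
the infimum over `μ ≠ 0` of the supremum over `q ≠ 0` of `⟨B q, μ⟩ / (‖q‖ ‖μ‖)` is positive.
The quotients are bounded by `‖B‖`, so the supremum is a genuine one. -/
def IsInfSupStable (B : P →L[ℝ] StrongDual ℝ Q) : Prop :=
  ∃ β : ℝ, 0 < β ∧ ∀ μ : Q, μ ≠ 0 →
    β ≤ ⨆ q : {q : P // q ≠ 0}, B q μ / (‖(q : P)‖ * ‖μ‖)

/-- `P_ker`, the kernel of the constraint operator. -/
def kerP (B : P →L[ℝ] StrongDual ℝ Q) : Submodule ℝ P :=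
  LinearMap.ker (B : P →ₗ[ℝ] StrongDual ℝ Q)

/-- `H_ker`, the closure in `H` of the kernel of the constraint operator. -/
def kerH (ι : P →L[ℝ] H) (B : P →L[ℝ] StrongDual ℝ Q) : Submodule ℝ H :=
  ((kerP B).map (ι : P →ₗ[ℝ] H)).topologicalClosure

/-- `(p, m, l)` is a pointwise (classical) solution on `[0, T]` of
`p' + A p - K^* m + B^* l = g` in `P^*`, `ε m' + K p + D m = f` in `M^*`, `B p = h` in `Q^*`
with initial values `p(0) = p₀` and `m(0) = m₀`. The function `p` takes values in `P` and is
differentiable as a function with values in `H`; derivatives at the end points are one-sided.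
The space `H` is embedded into `P^*` by the Riesz isomorphism of `H` followed by restriction
along `ι : P → H`, and `M` is identified with `M^*` by its Riesz isomorphism. -/
structure IsClassicalSolution
    (ι : P →L[ℝ] H) (A : H →L[ℝ] StrongDual ℝ H) (K : P →L[ℝ] StrongDual ℝ M)
    (D : M →L[ℝ] StrongDual ℝ M) (B : P →L[ℝ] StrongDual ℝ Q) (ε T : ℝ)
    (f : ℝ → StrongDual ℝ M) (g : ℝ → StrongDual ℝ P) (h : ℝ → StrongDual ℝ Q)
    (p₀ : P) (m₀ : M) (p : ℝ → P) (m : ℝ → M) (l : ℝ → Q) : Prop where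
  differentiableOn_p : DifferentiableOn ℝ (fun t => ι (p t)) (Icc 0 T)
  differentiableOn_m : DifferentiableOn ℝ m (Icc 0 T)
  eq_p : ∀ t ∈ Icc 0 T,
    (InnerProductSpace.toDual ℝ H (derivWithin (fun s => ι (p s)) (Icc 0 T) t)).comp ι
      + (A (ι (p t))).comp ι - K.flip (m t) + B.flip (l t) = g t
  eq_m : ∀ t ∈ Icc 0 T,
    ε • InnerProductSpace.toDual ℝ M (derivWithin m (Icc 0 T) t) + K (p t) + D (m t) = f t
  eq_constraint : ∀ t ∈ Icc 0 T, B (p t) = h t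
  init_p : p 0 = p₀
  init_m : m 0 = m₀

end Operators

end HyperbolicPDAE

/-! Inf-sup stability gives `B` a bounded right inverse `R`, and the lower bound for `K` on `ker B`
gives a lift `L` with `K^* L = id` as functionals on `ker B`. Writing `p = p_ker + R h` and `m = n -
L g₁` and testing only with `ker B` removes the constraint, the multiplier and the part `g₁` that
does not take values in `H`. What remains is an evolution equation for `(p_ker, n)` in `H_ker × M`.
Its forcing contains `R h'` and `L g₁'`, and this is where the second weak derivatives of `h` and
`g₁` enter.

After `n` is rescaled by `√ε` the coupling through `K` is skew, `D` is monotone, and `A` is bounded,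
so subtracting `‖A‖` makes the operator dissipative. It is maximal because the resolvent equation,
once the `M` component is eliminated, is elliptic on `ker B` (`isMaximalDissipative_coupledGraph`).
The compatibility condition says exactly that the initial value lies in the domain of this operator.

Such Cauchy problems are solved by Yosida approximation
(`IsMaximalDissipative.exists_classical_solution`). The approximate time derivatives are mild
solutions of the differentiated equation; they converge pointwise and boundedly, and the equation
survives the limit because the graph is closed. Continuity of `p_ker` in `P` comes from the second
equation, which expresses `K p_ker` through continuous functions. The residual of the first equation
is then a continuous `P^*`-valued function vanishing on `ker B`, hence equals `B^* λ` with `λ`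
continuous.

Uniqueness is the energy estimate for `‖p‖² + ε ‖m‖²` (`IsClassicalSolution.unique`).
One-dimensional Sobolev theory enters only to turn `H^1` and `H^2` data into primitives of
integrable functions. -/

namespace HyperbolicPDAE

/-! ### Primitives of integrable vector-valued functions -/

section Primitive

theorem _root_.IntervalIntegrable.mono_Icc {E : Type*} [NormedAddCommGroup E] {T t : ℝ} {G : ℝ → E}
    (hG : IntervalIntegrable G volume 0 T) (ht : t ∈ Icc 0 T) :
    IntervalIntegrable G volume 0 t := by
  refine hG.mono_set ?_
  rw [uIcc_of_le ht.1, uIcc_of_le (ht.1.trans ht.2)]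
  exact Icc_subset_Icc_right ht.2

variable {X Y : Type*} [NormedAddCommGroup X] [NormedSpace ℝ X] [NormedAddCommGroup Y]
  [NormedSpace ℝ Y]

/-- `F` is absolutely continuous on `[0, T]` with integrable density `G`. -/
def IsPrimitiveOn (T : ℝ) (F G : ℝ → X) : Prop :=
  IntervalIntegrable G volume 0 T ∧ ∀ t ∈ Icc 0 T, F t = F 0 + ∫ s in (0 : ℝ)..t, G s

theorem _root_.IntervalIntegrable.continuousOn_primitive {T : ℝ} {G : ℝ → X} (hT : 0 ≤ T)
    (hG : IntervalIntegrable G volume 0 T) :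
    ContinuousOn (fun t => ∫ s in (0 : ℝ)..t, G s) (Icc 0 T) := by
  have := intervalIntegral.continuousOn_primitive_interval' hG left_mem_uIcc
  rwa [uIcc_of_le hT] at this

theorem IsPrimitiveOn.continuousOn {T : ℝ} {F G : ℝ → X} (hT : 0 ≤ T)
    (h : IsPrimitiveOn T F G) : ContinuousOn F (Icc 0 T) :=
  (continuousOn_const.add (h.1.continuousOn_primitive hT)).congr fun t ht => h.2 t ht

theorem IsPrimitiveOn.add {T : ℝ} {F G F' G' : ℝ → X}
    (h : IsPrimitiveOn T F G) (h' : IsPrimitiveOn T F' G') :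
    IsPrimitiveOn T (fun t => F t + F' t) (fun t => G t + G' t) := by
  refine ⟨h.1.add h'.1, fun t ht => ?_⟩
  simp only
  rw [intervalIntegral.integral_add (h.1.mono_Icc ht) (h'.1.mono_Icc ht), h.2 t ht, h'.2 t ht]
  abel

theorem IsPrimitiveOn.clm [CompleteSpace X] [CompleteSpace Y] {T : ℝ} {F G : ℝ → X}
    (h : IsPrimitiveOn T F G) (L : X →L[ℝ] Y) :
    IsPrimitiveOn T (fun t => L (F t)) (fun t => L (G t)) := by
  refine ⟨⟨L.integrable_comp h.1.1, L.integrable_comp h.1.2⟩, fun t ht => ?_⟩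
  simp only
  rw [L.intervalIntegral_comp_comm (h.1.mono_Icc ht), h.2 t ht, map_add]

theorem IsPrimitiveOn.sub [CompleteSpace X] {T : ℝ} {F G F' G' : ℝ → X}
    (h : IsPrimitiveOn T F G) (h' : IsPrimitiveOn T F' G') :
    IsPrimitiveOn T (fun t => F t - F' t) (fun t => G t - G' t) := by
  simpa [sub_eq_add_neg] using h.add (h'.clm (-ContinuousLinearMap.id ℝ X))

theorem IsPrimitiveOn.hasDerivWithinAt [CompleteSpace X] {T : ℝ} {F G : ℝ → X} (hT : 0 ≤ T)
    (h : IsPrimitiveOn T F G) (hG : ContinuousOn G (Icc 0 T)) {t : ℝ} (ht : t ∈ Icc 0 T) :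
    HasDerivWithinAt F (G t) (Icc 0 T) t := by
  -- Extending `G` by its end values to a continuous function on the line yields a two-sided
  -- derivative, so the end points need no separate argument.
  have hc : Continuous (IccExtend hT ((Icc 0 T).domRestrict G)) :=
    (continuousOn_iff_continuous_domRestrict.mp hG).Icc_extend'
  have hd := (intervalIntegral.integral_hasDerivAt_right (hc.intervalIntegrable 0 t)
    (hc.stronglyMeasurableAtFilter _ _) hc.continuousAt).const_add (F 0)
  have he : ∀ s ∈ Icc 0 T, IccExtend hT ((Icc 0 T).domRestrict G) s = G s := fun s hs => by
    rw [IccExtend_of_mem hT _ hs]; rfl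
  rw [he t ht] at hd
  refine hd.hasDerivWithinAt.congr_of_mem (fun s hs => ?_) ht
  rw [h.2 s hs]
  congr 1
  refine intervalIntegral.integral_congr fun r hr => (he r ?_).symm
  rw [uIcc_of_le hs.1] at hr
  exact ⟨hr.1, hr.2.trans hs.2⟩

/-- Integration by parts of a continuously differentiable operator-valued function against a
primitive of an integrable function. -/
theorem integral_deriv_apply_primitive [CompleteSpace X] [CompleteSpace Y] {b : ℝ} (hb : 0 ≤ b)
    {Φ Φ' : ℝ → X →L[ℝ] Y} (hΦ : ∀ s, HasDerivAt Φ (Φ' s) s) (hΦ' : Continuous Φ')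
    {G : ℝ → X} (hG : IntervalIntegrable G volume 0 b) :
    ∫ s in (0 : ℝ)..b, Φ' s (∫ r in (0 : ℝ)..s, G r) =
      Φ b (∫ r in (0 : ℝ)..b, G r) - ∫ s in (0 : ℝ)..b, Φ s (G s) := by
  have hGi : IntegrableOn G (Ioc 0 b) := (intervalIntegrable_iff_integrableOn_Ioc_of_le hb).1 hG
  have hΦc : Continuous Φ := continuous_iff_continuousAt.2 fun s => (hΦ s).continuousAt
  set μ := volume.restrict (Ioc (0 : ℝ) b) with hμ
  obtain ⟨C, hC⟩ := (isCompact_Icc (a := (0 : ℝ)) (b := b)).exists_bound_of_continuousOn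
    hΦ'.continuousOn
  obtain ⟨C₁, hC₁⟩ := (isCompact_Icc (a := (0 : ℝ)) (b := b)).exists_bound_of_continuousOn
    hΦc.continuousOn
  -- Both sides are iterated integrals of this kernel over the triangle `r ≤ s`; Fubini exchanges
  -- them, and the inner `s`-integral is `Φ b - Φ r`.
  let k : ℝ → ℝ → Y := fun s r => {p : ℝ × ℝ | p.2 ≤ p.1}.indicator
    (fun p => Φ' p.1 (G p.2)) (s, r)
  have hk : Integrable (Function.uncurry k) (μ.prod μ) := by
    have hs : MeasurableSet {p : ℝ × ℝ | p.2 ≤ p.1} := measurableSet_le measurable_snd measurable_fst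
    have hm : AEStronglyMeasurable (fun p : ℝ × ℝ => Φ' p.1 (G p.2)) (μ.prod μ) := by
      have h1 : AEStronglyMeasurable (fun p : ℝ × ℝ => Φ' p.1) (μ.prod μ) :=
        (hΦ'.comp continuous_fst).aestronglyMeasurable
      have h2 : AEStronglyMeasurable (fun p : ℝ × ℝ => G p.2) (μ.prod μ) :=
        hGi.aestronglyMeasurable.comp_snd
      exact (isBoundedBilinearMap_apply (𝕜 := ℝ) (E := X) (F := Y)).continuous.comp_aestronglyMeasurable
        (h1.prodMk h2)
    have hi : Integrable (fun p : ℝ × ℝ => Φ' p.1 (G p.2)) (μ.prod μ) := by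
      refine Integrable.mono' ((hGi.norm.const_mul C).comp_snd μ) hm ?_
      have : ∀ᵐ p : ℝ × ℝ ∂(μ.prod μ), p.1 ∈ Ioc 0 b :=
        Measure.quasiMeasurePreserving_fst.ae (ae_restrict_mem measurableSet_Ioc)
      filter_upwards [this] with p hp
      exact ((Φ' p.1).le_opNorm _).trans
        (mul_le_mul_of_nonneg_right (hC _ (Ioc_subset_Icc_self hp)) (norm_nonneg _))
    exact hi.indicator hs
  have hleft : ∫ s in (0 : ℝ)..b, Φ' s (∫ r in (0 : ℝ)..s, G r) = ∫ s, ∫ r, k s r ∂μ ∂μ := by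
    rw [intervalIntegral.integral_of_le hb]
    refine setIntegral_congr_fun measurableSet_Ioc fun s hs => ?_
    have hks : k s = (Iic s).indicator fun r => Φ' s (G r) := by
      ext r; simp only [k, indicator, mem_ofPred_eq, mem_Iic]
    change _ = ∫ r, k s r ∂μ
    rw [hks, integral_indicator measurableSet_Iic, hμ, Measure.restrict_restrict measurableSet_Iic,
      ← (Φ' s).intervalIntegral_comp_comm (hG.mono_Icc (Ioc_subset_Icc_self hs)),
      intervalIntegral.integral_of_le hs.1.le]
    congr 2
    ext r; simp only [mem_Ioc, mem_inter_iff, mem_Iic]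
    constructor
    · rintro ⟨h1, h2⟩; exact ⟨h2, h1, h2.trans hs.2⟩
    · rintro ⟨h1, h2, -⟩; exact ⟨h2, h1⟩
  have hright : ∫ r, ∫ s, k s r ∂μ ∂μ = ∫ r in (0 : ℝ)..b, (Φ b (G r) - Φ r (G r)) := by
    rw [intervalIntegral.integral_of_le hb]
    refine setIntegral_congr_fun measurableSet_Ioc fun r hr => ?_
    have hkr : (fun s => k s r) = (Ici r).indicator fun s => Φ' s (G r) := by
      ext s; simp only [k, indicator, mem_ofPred_eq, mem_Ici]
    change ∫ s, k s r ∂μ = _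
    have hset : Ici r ∩ Ioc 0 b = Icc r b := by
      ext s; simp only [mem_Ioc, mem_inter_iff, mem_Ici, mem_Icc]
      constructor
      · rintro ⟨h1, -, h2⟩; exact ⟨h1, h2⟩
      · rintro ⟨h1, h2⟩; exact ⟨h1, hr.1.trans_le h1, h2⟩
    rw [hkr, integral_indicator measurableSet_Ici, hμ, Measure.restrict_restrict measurableSet_Ici,
      hset, integral_Icc_eq_integral_Ioc, ← intervalIntegral.integral_of_le hr.2]
    have hd : ∀ s ∈ uIcc r b, HasDerivAt (fun s => Φ s (G r)) (Φ' s (G r)) s := fun s _ => by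
      simpa using (hΦ s).clm_apply (hasDerivAt_const s (G r))
    exact intervalIntegral.integral_eq_sub_of_hasDerivAt hd
      ((hΦ'.clm_apply continuous_const).intervalIntegrable _ _)
  have hi1 : IntervalIntegrable (fun r => Φ b (G r)) volume 0 b :=
    ⟨(Φ b).integrable_comp hG.1, (Φ b).integrable_comp hG.2⟩
  have hi2 : IntervalIntegrable (fun r => Φ r (G r)) volume 0 b := by
    rw [intervalIntegrable_iff_integrableOn_Ioc_of_le hb]
    refine Integrable.mono' (hGi.norm.const_mul C₁) ?_ ?_
    · exact (isBoundedBilinearMap_apply (𝕜 := ℝ) (E := X) (F := Y)).continuous.comp_aestronglyMeasurable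
        (hΦc.aestronglyMeasurable.prodMk hGi.aestronglyMeasurable)
    · filter_upwards [ae_restrict_mem measurableSet_Ioc] with p hp
      exact ((Φ p).le_opNorm _).trans
        (mul_le_mul_of_nonneg_right (hC₁ _ (Ioc_subset_Icc_self hp)) (norm_nonneg _))
  rw [hleft, integral_integral_swap hk, hright, intervalIntegral.integral_sub hi1 hi2,
    (Φ b).intervalIntegral_comp_comm hG]

end Primitive

/-! ### Weak derivatives and absolutely continuous representatives -/

section WeakDerivative

variable {X : Type*} [NormedAddCommGroup X] [NormedSpace ℝ X]

theorem exists_Icc_of_isCompact_subset_Ioo {T : ℝ} {K : Set ℝ} (hT : 0 < T) (hK : IsCompact K)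
    (hKT : K ⊆ Ioo 0 T) : ∃ a b, 0 < a ∧ b < T ∧ K ⊆ Icc a b := by
  rcases K.eq_empty_or_nonempty with rfl | hne
  -- For empty `K` any `a > 0` and `b < T` will do; the interval may itself be empty.
  · exact ⟨T, 0, hT, hT, empty_subset _⟩
  · exact ⟨sInf K, sSup K, (hKT (hK.sInf_mem hne)).1, (hKT (hK.sSup_mem hne)).2, fun x hx =>
      ⟨csInf_le hK.bddBelow hx, le_csSup hK.bddAbove hx⟩⟩

/-- A smooth function of vanishing integral with compact support in `(0, T)` has a primitive which
is a test function on `(0, T)`. -/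
theorem exists_testFunction_deriv_eq {T : ℝ} (hT : 0 < T) {θ : ℝ → ℝ} (hθ : ContDiff ℝ ∞ θ)
    (hc : HasCompactSupport θ) (hsub : tsupport θ ⊆ Ioo 0 T) (h0 : ∫ t, θ t = 0) :
    ∃ φ : ℝ → ℝ, ContDiff ℝ ∞ φ ∧ HasCompactSupport φ ∧ tsupport φ ⊆ Ioo 0 T ∧ deriv φ = θ := by
  obtain ⟨a, b, ha, hb, hab⟩ := exists_Icc_of_isCompact_subset_Ioo hT hc hsub
  have hz : ∀ x, x ∉ Icc a b → θ x = 0 := fun x hx =>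
    image_eq_zero_of_notMem_tsupport fun h => hx (hab h)
  let φ : ℝ → ℝ := fun x => ∫ y in (0 : ℝ)..x, θ y
  have hd : ∀ x, HasDerivAt φ (θ x) x := fun x =>
    intervalIntegral.integral_hasDerivAt_right (hθ.continuous.intervalIntegrable _ _)
      (hθ.continuous.stronglyMeasurableAtFilter _ _) hθ.continuous.continuousAt
  have hderiv : deriv φ = θ := funext fun x => (hd x).deriv
  have hsupp : tsupport φ ⊆ Icc a b := by
    refine closure_minimal (fun x hx => ?_) isClosed_Icc
    by_contra hx'
    refine hx ?_
    rw [mem_Icc, not_and_or, not_le, not_le] at hx'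
    rcases hx' with hx' | hx'
    · refine intervalIntegral.integral_zero_ae (Filter.Eventually.of_forall fun y hy => hz y ?_)
      intro hy'
      rw [uIoc, mem_Ioc] at hy
      have := hy'.1.trans hy.2
      rcases le_max_iff.1 this with h | h <;> linarith
    · change ∫ y in (0 : ℝ)..x, θ y = 0
      rw [intervalIntegral.integral_eq_integral_of_support_subset, h0]
      intro y hy
      have : y ∈ Icc a b := by
        by_contra h
        exact hy (hz y h)
      exact ⟨ha.trans_le this.1, this.2.trans hx'.le⟩
  refine ⟨φ, ?_, ?_, ?_, hderiv⟩
  · rw [contDiff_infty_iff_deriv, hderiv]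
    exact ⟨fun x => (hd x).differentiableAt, hθ⟩
  · exact isCompact_Icc.of_isClosed_subset (isClosed_tsupport _) hsupp
  · exact hsupp.trans fun x hx => ⟨ha.trans_le hx.1, hx.2.trans_lt hb⟩

/-- The lemma of du Bois-Reymond. -/
theorem IsWeakDeriv.ae_eq_const [CompleteSpace X] {T : ℝ} (hT : 0 < T) {u : ℝ → X}
    (hu : IntegrableOn u (Ioo 0 T)) (h : IsWeakDeriv T u 0) :
    ∃ c : X, ∀ᵐ t, t ∈ Ioo 0 T → u t = c := by
  -- Centre and outer radius keep the closed support inside `[T/4, 3T/4]`. The normalised bump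
  -- serves to correct the integral of other test functions.
  let β : ContDiffBump (T / 2) := ⟨T / 8, T / 4, by positivity, by linarith⟩
  set ψ : ℝ → ℝ := β.normed volume with hψ
  have hψs : ContDiff ℝ ∞ ψ := β.contDiff_normed
  have hψc : HasCompactSupport ψ := β.hasCompactSupport_normed
  have hψ1 : ∫ x, ψ x = 1 := β.integral_normed
  have hψT : tsupport ψ ⊆ Ioo 0 T := by
    rw [hψ, β.tsupport_normed_eq, Real.closedBall_eq_Icc]
    intro x hx
    have h1 : T / 2 - T / 4 ≤ x := hx.1
    have h2 : x ≤ T / 2 + T / 4 := hx.2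
    constructor <;> linarith
  have hint : ∀ η : ℝ → ℝ, Continuous η → HasCompactSupport η →
      IntegrableOn (fun t => η t • u t) (Ioo 0 T) := fun η hη hηc => by
    obtain ⟨C, hC⟩ := hη.bounded_above_of_compact_support hηc
    exact Integrable.bdd_smul (𝕜 := ℝ) hu hη.aestronglyMeasurable (C := C)
      (Filter.Eventually.of_forall hC)
  set c : X := ∫ t in Ioo 0 T, ψ t • u t with hcdef
  refine ⟨c, ?_⟩
  have key := isOpen_Ioo.ae_eq_zero_of_integral_contDiff_smul_eq_zero (μ := volume)
    (f := fun t => u t - c) (U := Ioo 0 T)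
    (hu.locallyIntegrableOn.sub (locallyIntegrableOn_const c)) (fun η hη hηc hηT => ?_)
  · filter_upwards [key] with t ht htT
    exact sub_eq_zero.1 (ht htT)
  -- `η - (∫ η) ψ` has integral zero, so it is the derivative of a test function and `u` annihilates
  -- it. Hence `∫ η u = (∫ η) c`.
  · set I := ∫ x, η x with hI
    have hθ : ContDiff ℝ ∞ fun t => η t - I * ψ t := hη.sub (contDiff_const.mul hψs)
    have hIψ : tsupport (fun t => I * ψ t) ⊆ tsupport ψ := tsupport_mul_subset_right
    have hθT : tsupport (fun t => η t - I * ψ t) ⊆ Ioo 0 T :=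
      (tsupport_sub _ _).trans (union_subset hηT (hIψ.trans hψT))
    have hθc : HasCompactSupport fun t => η t - I * ψ t := hηc.sub hψc.mul_left
    have hθ0 : ∫ t, (η t - I * ψ t) = 0 := by
      rw [integral_sub (hη.continuous.integrable_of_hasCompactSupport hηc)
        ((hψs.continuous.integrable_of_hasCompactSupport hψc).const_mul I), integral_const_mul, hψ1]
      simp [hI]
    obtain ⟨φ, hφ, hφc, hφT, hφd⟩ := exists_testFunction_deriv_eq hT hθ hθc hθT hθ0
    have h1 := h φ hφ hφc hφT
    rw [hφd] at h1
    simp only [Pi.zero_apply, smul_zero, integral_zero, neg_zero] at h1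
    have h2 : ∫ t in Ioo 0 T, η t • u t = I • c := by
      have e : ∀ t, (η t - I * ψ t) • u t = η t • u t - I • ψ t • u t := fun t => by
        rw [sub_smul, mul_smul]
      simp only [e] at h1
      have hψi : IntegrableOn (fun t => I • ψ t • u t) (Ioo 0 T) :=
        (hint ψ hψs.continuous hψc).smul I
      rw [integral_sub (hint η hη.continuous hηc) hψi, integral_smul] at h1
      exact sub_eq_zero.1 h1
    have hηz : ∀ t, t ∉ Ioo 0 T → η t = 0 := fun t ht =>
      image_eq_zero_of_notMem_tsupport fun h => ht (hηT h)
    rw [← setIntegral_eq_integral_of_forall_compl_eq_zero (s := Ioo 0 T)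
      (fun t ht => by rw [hηz t ht, zero_smul])]
    simp only [smul_sub]
    rw [integral_sub (hint η hη.continuous hηc)
      ((hη.continuous.integrable_of_hasCompactSupport hηc).integrableOn.smul_const c), h2,
      integral_smul_const, setIntegral_eq_integral_of_forall_compl_eq_zero hηz, sub_self]

/-- Integration by parts with the operator function `φ(s) • id`; the boundary term vanishes because
`T` lies outside the support of `φ`. -/
theorem isWeakDeriv_primitive [CompleteSpace X] {T : ℝ} (hT : 0 < T) {w : ℝ → X}
    (hw : IntervalIntegrable w volume 0 T) :
    IsWeakDeriv T (fun t => ∫ s in (0 : ℝ)..t, w s) w := by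
  intro φ hφ hφc hφT
  have hd : ∀ s, HasDerivAt (fun s => φ s • ContinuousLinearMap.id ℝ X)
      (deriv φ s • ContinuousLinearMap.id ℝ X) s := fun s =>
    HasDerivAt.smul_const (F := X →L[ℝ] X)
      ((hφ.differentiable (by simp)).differentiableAt.hasDerivAt) (ContinuousLinearMap.id ℝ X)
  have hφ' : Continuous (deriv φ) := hφ.continuous_deriv (by simp)
  have key := integral_deriv_apply_primitive hT.le hd (hφ'.smul continuous_const) hw
  have hφTz : φ T = 0 := image_eq_zero_of_notMem_tsupport fun h => (hφT h).2.ne rfl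
  simp only [hφTz, zero_smul, zero_apply, zero_sub,
    smul_apply, ContinuousLinearMap.id_apply] at key
  rwa [intervalIntegral.integral_of_le hT.le, intervalIntegral.integral_of_le hT.le,
    integral_Ioc_eq_integral_Ioo, integral_Ioc_eq_integral_Ioo] at key

theorem MemSobolevBochner.memLp {T : ℝ} {k : ℕ} {u : ℝ → X} (h : MemSobolevBochner T k u) :
    MemLp u 2 (volume.restrict (Ioo 0 T)) := by
  cases k with
  | zero => exact h
  | succ k => exact h.1

theorem MemSobolevBochner.intervalIntegrable {T : ℝ} (hT : 0 < T) {k : ℕ} {u : ℝ → X}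
    (h : MemSobolevBochner T k u) : IntervalIntegrable u volume 0 T := by
  rw [intervalIntegrable_iff_integrableOn_Ioo_of_le hT.le]
  exact h.memLp.integrable (by norm_num)

/-- A function with an integrable weak derivative has an absolutely continuous representative. -/
theorem IsWeakDeriv.ae_eq_primitive [CompleteSpace X] {T : ℝ} (hT : 0 < T) {u v : ℝ → X}
    (hu : IntervalIntegrable u volume 0 T) (hv : IntervalIntegrable v volume 0 T)
    (h : IsWeakDeriv T u v) :
    ∃ c : X, ∀ᵐ t, t ∈ Ioo 0 T → u t = c + ∫ s in (0 : ℝ)..t, v s := by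
  have hVi : IntervalIntegrable (fun t => ∫ s in (0 : ℝ)..t, v s) volume 0 T :=
    ContinuousOn.intervalIntegrable (by rw [uIcc_of_le hT.le]; exact hv.continuousOn_primitive hT.le)
  have hw : IsWeakDeriv T (fun t => u t - ∫ s in (0 : ℝ)..t, v s) 0 := by
    intro φ hφ hφc hφT
    have hφ' : Continuous (deriv φ) := hφ.continuous_deriv (by simp)
    have hb : ∀ z : ℝ → X, IntervalIntegrable z volume 0 T →
        IntegrableOn (fun t => deriv φ t • z t) (Ioo 0 T) := fun z hz => by
      rw [intervalIntegrable_iff_integrableOn_Ioo_of_le hT.le] at hz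
      obtain ⟨C, hC⟩ := hφ'.bounded_above_of_compact_support hφc.deriv
      exact Integrable.bdd_smul (𝕜 := ℝ) hz hφ'.aestronglyMeasurable
        (C := C) (Filter.Eventually.of_forall hC)
    simp only [smul_sub, Pi.zero_apply, smul_zero, integral_zero, neg_zero]
    rw [integral_sub (hb _ hu) (hb _ hVi), h φ hφ hφc hφT,
      isWeakDeriv_primitive hT hv φ hφ hφc hφT, sub_self]
  obtain ⟨c, hc⟩ := hw.ae_eq_const hT
    ((intervalIntegrable_iff_integrableOn_Ioo_of_le hT.le).1 (hu.sub hVi))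
  refine ⟨c, ?_⟩
  filter_upwards [hc] with t ht htT
  rw [← ht htT, sub_add_cancel]

/-- Two continuous functions that agree almost everywhere on a nondegenerate interval agree
everywhere, end points included. This fixes the point values used in the initial conditions. -/
theorem isPrimitiveOn_of_isWeakDeriv [CompleteSpace X] {T : ℝ} (hT : 0 < T) {u v : ℝ → X}
    (hu : ContinuousOn u (Icc 0 T)) (hv : IntervalIntegrable v volume 0 T)
    (h : IsWeakDeriv T u v) : IsPrimitiveOn T u v := by
  obtain ⟨c, hc⟩ := h.ae_eq_primitive hT
    (ContinuousOn.intervalIntegrable (by rwa [uIcc_of_le hT.le])) hv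
  have hEq : EqOn u (fun t => c + ∫ s in (0 : ℝ)..t, v s) (Icc 0 T) := by
    refine Measure.eqOn_Icc_of_ae_eq volume hT.ne ?_ hu
      (continuousOn_const.add (hv.continuousOn_primitive hT.le))
    rw [← restrict_Ioo_eq_restrict_Icc]
    exact (ae_restrict_iff' measurableSet_Ioo).2 hc
  have h0 : u 0 = c := by simpa using hEq (left_mem_Icc.2 hT.le)
  exact ⟨hv, fun t ht => by rw [hEq ht, h0]⟩

theorem IsSobolevRepresentative.exists_isPrimitiveOn [CompleteSpace X] {T : ℝ} (hT : 0 < T)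
    {u : ℝ → X} (hu : IsSobolevRepresentative T 1 u) : ∃ v, IsPrimitiveOn T u v := by
  obtain ⟨hc, -, v, hv, hvL⟩ := hu
  exact ⟨v, isPrimitiveOn_of_isWeakDeriv hT hc (hvL.intervalIntegrable hT) hv⟩

theorem IsSobolevRepresentative.exists_isPrimitiveOn_two [CompleteSpace X] {T : ℝ} (hT : 0 < T)
    {u : ℝ → X} (hu : IsSobolevRepresentative T 2 u) :
    ∃ v w, IsPrimitiveOn T u v ∧ IsPrimitiveOn T v w := by
  obtain ⟨hc, -, v, hv, hvL, w, hw, hwL⟩ := hu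
  have hvI : IntervalIntegrable v volume 0 T := MemSobolevBochner.intervalIntegrable (k := 0) hT hvL
  have hwI := hwL.intervalIntegrable hT
  obtain ⟨c, hc'⟩ := hw.ae_eq_primitive hT hvI hwI
  -- The first weak derivative is only determined almost everywhere; it is replaced by its
  -- absolutely continuous representative, which has the same primitive.
  let v' : ℝ → X := fun t => c + ∫ s in (0 : ℝ)..t, w s
  have hv' : IsPrimitiveOn T v' w := ⟨hwI, fun t _ => by simp [v']⟩
  have hcv' := hv'.continuousOn hT.le
  have hp := isPrimitiveOn_of_isWeakDeriv hT hc hvI hv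
  have hp' : IsPrimitiveOn T u v' := by
    refine ⟨ContinuousOn.intervalIntegrable (by rwa [uIcc_of_le hT.le]), fun t ht => ?_⟩
    rw [hp.2 t ht]
    congr 1
    refine intervalIntegral.integral_congr_ae ?_
    have hne : ∀ᵐ s : ℝ, s ≠ T := by simp [ae_iff]
    filter_upwards [hc', hne] with s hs hsT hst
    rw [uIoc_of_le ht.1] at hst
    exact hs ⟨hst.1, lt_of_le_of_ne (hst.2.trans ht.2) hsT⟩
  exact ⟨v', w, hp', hv'⟩

end WeakDerivative

/-! ### Gronwall's inequality -/

open Filter Topology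

/-- A differential form of Gronwall's inequality. -/
theorem le_exp_mul_of_hasDerivWithinAt {T w : ℝ} {E E' : ℝ → ℝ}
    (hE : ∀ t ∈ Icc 0 T, HasDerivWithinAt E (E' t) (Icc 0 T) t)
    (h : ∀ t ∈ Icc 0 T, E' t ≤ w * E t) {t : ℝ} (ht : t ∈ Icc 0 T) :
    E t ≤ Real.exp (w * t) * E 0 := by
  have hd : ∀ s ∈ Icc 0 T, HasDerivWithinAt (fun s => Real.exp (-(w * s)) * E s)
      (Real.exp (-(w * s)) * (E' s - w * E s)) (Icc 0 T) s := fun s hs => by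
    have h1 : HasDerivAt (fun s : ℝ => Real.exp (-(w * s))) (Real.exp (-(w * s)) * -(w * 1)) s :=
      (((hasDerivAt_id s).const_mul w).neg).exp
    exact (h1.hasDerivWithinAt.mul (hE s hs)).congr_deriv (by ring)
  have hanti : AntitoneOn (fun s => Real.exp (-(w * s)) * E s) (Icc 0 T) := by
    refine antitoneOn_of_hasDerivWithinAt_nonpos (convex_Icc 0 T)
      (f' := fun s => Real.exp (-(w * s)) * (E' s - w * E s))
      (fun s hs => (hd s hs).continuousWithinAt)
      (fun s hs => (hd s (interior_subset hs)).mono interior_subset) fun s hs => ?_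
    exact mul_nonpos_of_nonneg_of_nonpos (Real.exp_pos _).le
      (sub_nonpos.2 (h s (interior_subset hs)))
  have := hanti ⟨le_rfl, ht.1.trans ht.2⟩ ht ht.1
  simp only [mul_zero, neg_zero, Real.exp_zero, one_mul] at this
  calc E t = Real.exp (w * t) * (Real.exp (-(w * t)) * E t) := by
        rw [← mul_assoc, ← Real.exp_add]; simp
    _ ≤ _ := mul_le_mul_of_nonneg_left this (Real.exp_pos _).le

/-! ### Exponential groups of bounded operators -/

section BoundedGenerator

variable {X : Type*} [NormedAddCommGroup X] [InnerProductSpace ℝ X]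

/-- The group generated by a bounded operator. -/
noncomputable def expGroup (B : X →L[ℝ] X) (t : ℝ) : X →L[ℝ] X := NormedSpace.exp (t • B)

theorem expGroup_zero (B : X →L[ℝ] X) : expGroup B 0 = 1 := by
  simp [expGroup]

theorem expGroup_zero_apply (B : X →L[ℝ] X) (x : X) : expGroup B 0 x = x := by
  rw [expGroup_zero]; rfl

theorem commute_expGroup {B C : X →L[ℝ] X} (h : Commute B C) (t : ℝ) :
    Commute B (expGroup C t) := by
  let _ : NormedAlgebra ℚ (X →L[ℝ] X) := NormedAlgebra.restrictScalars ℚ ℝ _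
  exact (h.smul_right t).exp_right

variable [CompleteSpace X]

theorem hasDerivAt_expGroup (B : X →L[ℝ] X) (t : ℝ) :
    HasDerivAt (expGroup B) (B * expGroup B t) t :=
  hasDerivAt_exp_smul_const' B t

theorem continuous_expGroup (B : X →L[ℝ] X) : Continuous (expGroup B) :=
  continuous_iff_continuousAt.2 fun t => (hasDerivAt_expGroup B t).continuousAt

theorem expGroup_add (B : X →L[ℝ] X) (s t : ℝ) :
    expGroup B (s + t) = expGroup B s * expGroup B t := by
  let _ : NormedAlgebra ℚ (X →L[ℝ] X) := NormedAlgebra.restrictScalars ℚ ℝ _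
  rw [expGroup, add_smul, NormedSpace.exp_add_of_commute]; · rfl
  exact ((Commute.refl B).smul_left s).smul_right t

theorem hasDerivAt_expGroup_apply (B : X →L[ℝ] X) (x : X) (t : ℝ) :
    HasDerivAt (fun t => expGroup B t x) (B (expGroup B t x)) t := by
  simpa using (hasDerivAt_expGroup B t).clm_apply (hasDerivAt_const t x)

/-- Gronwall applied to the squared norm, whose derivative is at most `2w` times itself. The bound
sees only the one-sided constant `w`, not `‖B‖`, so it can be uniform along approximations of an
unbounded operator. -/
theorem norm_expGroup_apply_le {B : X →L[ℝ] X} {w : ℝ} (hB : ∀ x, ⟪B x, x⟫_ℝ ≤ w * ‖x‖ ^ 2)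
    {t : ℝ} (ht : 0 ≤ t) (x : X) : ‖expGroup B t x‖ ≤ Real.exp (w * t) * ‖x‖ := by
  have h := le_exp_mul_of_hasDerivWithinAt (T := t) (w := 2 * w)
    (E := fun s => ‖expGroup B s x‖ ^ 2)
    (fun s _ => (hasDerivAt_expGroup_apply B x s).norm_sq.hasDerivWithinAt)
    (fun s _ => by
      have := hB (expGroup B s x)
      rw [real_inner_comm] at this
      linarith) ⟨ht, le_rfl⟩
  simp only [expGroup_zero_apply] at h
  refine le_of_sq_le_sq ?_ (by positivity)
  rw [mul_pow, ← Real.exp_nat_mul, show ((2 : ℕ) : ℝ) * (w * t) = 2 * w * t by push_cast; ring]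
  exact h

/-- The path `s ↦ e^{sB} e^{(t-s)C} x` joins the two orbits. By commutativity its derivative is
`e^{sB} e^{(t-s)C} (B x - C x)`, and the two growth factors multiply to `e^{wt}`. -/
theorem norm_expGroup_sub_le {B C : X →L[ℝ] X} {w : ℝ}
    (hB : ∀ x, ⟪B x, x⟫_ℝ ≤ w * ‖x‖ ^ 2) (hC : ∀ x, ⟪C x, x⟫_ℝ ≤ w * ‖x‖ ^ 2)
    (hBC : Commute B C) {t : ℝ} (ht : 0 ≤ t) (x : X) :
    ‖expGroup B t x - expGroup C t x‖ ≤ Real.exp (w * t) * ‖B x - C x‖ * t := by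
  have hd : ∀ s ∈ Icc 0 t, HasDerivWithinAt (fun s => expGroup B s (expGroup C (t - s) x))
      (expGroup B s (expGroup C (t - s) (B x - C x))) (Icc 0 t) s := fun s _ => by
    have h1 := hasDerivAt_expGroup B s
    have h2 : HasDerivAt (fun s => expGroup C (t - s) x) (-(C (expGroup C (t - s) x))) s := by
      exact ((hasDerivAt_expGroup_apply C x (t - s)).scomp s
        ((hasDerivAt_const s t).sub (hasDerivAt_id s))).congr_deriv (by simp)
    refine ((h1.clm_apply h2).hasDerivWithinAt).congr_deriv ?_
    have e1 : B * expGroup B s = expGroup B s * B := commute_expGroup (Commute.refl B) s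
    have e2 : B * expGroup C (t - s) = expGroup C (t - s) * B := commute_expGroup hBC _
    have e3 : C * expGroup C (t - s) = expGroup C (t - s) * C := commute_expGroup (Commute.refl C) _
    have e2' := DFunLike.congr_fun e2 x
    have e3' := DFunLike.congr_fun e3 x
    simp only [mul_apply_eq_comp] at e2' e3'
    rw [e1, mul_apply_eq_comp, e2', map_neg, e3', map_sub, map_sub]
    abel
  have hb : ∀ s ∈ Ico 0 t, ‖expGroup B s (expGroup C (t - s) (B x - C x))‖ ≤
      Real.exp (w * t) * ‖B x - C x‖ := fun s hs => by
    refine (norm_expGroup_apply_le hB hs.1 _).trans ?_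
    refine (mul_le_mul_of_nonneg_left (norm_expGroup_apply_le hC (sub_nonneg.2 hs.2.le) _)
      (Real.exp_pos _).le).trans (le_of_eq ?_)
    rw [← mul_assoc, ← Real.exp_add]
    congr 2; ring
  have h := norm_image_sub_le_of_norm_deriv_le_segment' hd hb t ⟨ht, le_rfl⟩
  simpa [expGroup_zero_apply] using h

theorem expGroup_apply_neg_apply (B : X →L[ℝ] X) (s t : ℝ) (x : X) :
    expGroup B t (expGroup B (-s) x) = expGroup B (t - s) x := by
  rw [sub_eq_add_neg, expGroup_add]; rfl

theorem intervalIntegrable_expGroup_neg (B : X →L[ℝ] X) {T : ℝ} {G : ℝ → X}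
    (hG : IntervalIntegrable G volume 0 T) :
    IntervalIntegrable (fun r => expGroup B (-r) (G r)) volume 0 T := by
  have hc : Continuous fun r => expGroup B (-r) := (continuous_expGroup B).comp continuous_neg
  obtain ⟨C, hC⟩ := (isCompact_uIcc (a := (0 : ℝ)) (b := T)).exists_bound_of_continuousOn
    hc.continuousOn
  refine (hG.norm.const_mul C).mono_fun' ?_ ?_
  · exact (isBoundedBilinearMap_apply (𝕜 := ℝ) (E := X) (F := X)).continuous.comp_aestronglyMeasurable
      (hc.aestronglyMeasurable.prodMk hG.def'.aestronglyMeasurable)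
  · filter_upwards [ae_restrict_mem measurableSet_uIoc] with p hp
    exact ((expGroup B (-p)).le_opNorm _).trans
      (mul_le_mul_of_nonneg_right (hC _ (uIoc_subset_uIcc hp)) (norm_nonneg _))

/-- The time derivative of the mild solution of `u' = B u + F`, `F' = G`, is the mild solution
`v` of the differentiated equation. -/
theorem mild_solution_derivative (B : X →L[ℝ] X) {T : ℝ} {F G : ℝ → X}
    (hF : IsPrimitiveOn T F G) (u₀ : X) {v : ℝ → X}
    (hv : ∀ t ∈ Icc 0 T, v t = expGroup B t (B u₀ + F 0) +
      ∫ r in (0 : ℝ)..t, expGroup B (t - r) (G r)) :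
    ContinuousOn v (Icc 0 T) ∧
      ∀ t ∈ Icc 0 T, v t = B (u₀ + ∫ s in (0 : ℝ)..t, v s) + F t := by
  rcases lt_or_ge T 0 with hT | hT
  · simp [Icc_eq_empty hT.not_ge]
  set y := B u₀ + F 0 with hy
  have hi := intervalIntegrable_expGroup_neg B hF.1
  have hc := hi.continuousOn_primitive hT
  -- By the group law the convolution is `e^{tB}` applied to a primitive, so that integration by
  -- parts computes `B ∫ v`.
  have hv' : ∀ t ∈ Icc 0 T,
      v t = expGroup B t y + expGroup B t (∫ r in (0 : ℝ)..t, expGroup B (-r) (G r)) := fun t ht => by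
    rw [hv t ht, ← (expGroup B t).intervalIntegral_comp_comm (hi.mono_Icc ht)]
    simp only [expGroup_apply_neg_apply]
  have hcv : ContinuousOn v (Icc 0 T) :=
    ((((continuous_expGroup B).clm_apply continuous_const).continuousOn).add
      ((continuous_expGroup B).continuousOn.clm_apply hc)).congr hv'
  refine ⟨hcv, fun t ht => ?_⟩
  have hmem : ∀ s ∈ uIcc 0 t, s ∈ Icc 0 T := fun s hs => by
    rw [uIcc_of_le ht.1] at hs; exact ⟨hs.1, hs.2.trans ht.2⟩
  have hvi : IntervalIntegrable v volume 0 t := ContinuousOn.intervalIntegrable (hcv.mono hmem)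
  have hBc : Continuous fun s => B * expGroup B s := continuous_const.mul (continuous_expGroup B)
  have hparts := integral_deriv_apply_primitive ht.1 (hasDerivAt_expGroup B) hBc (hi.mono_Icc ht)
  have hftc : ∫ s in (0 : ℝ)..t, B (expGroup B s y) = expGroup B t y - y := by
    rw [intervalIntegral.integral_eq_sub_of_hasDerivAt
      (fun s _ => hasDerivAt_expGroup_apply B y s)
      ((B.continuous.comp ((continuous_expGroup B).clm_apply continuous_const)).intervalIntegrable _ _),
      expGroup_zero_apply]
  have h1 : B (∫ s in (0 : ℝ)..t, v s) = (expGroup B t y - y) +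
      ∫ s in (0 : ℝ)..t, (B * expGroup B s) (∫ r in (0 : ℝ)..s, expGroup B (-r) (G r)) := by
    rw [← B.intervalIntegral_comp_comm hvi, ← hftc, ← intervalIntegral.integral_add]
    · refine intervalIntegral.integral_congr fun s hs => ?_
      rw [hv' s (hmem s hs), map_add]; rfl
    · exact (B.continuous.comp
        ((continuous_expGroup B).clm_apply continuous_const)).intervalIntegrable _ _
    · exact ContinuousOn.intervalIntegrable (hBc.continuousOn.clm_apply (hc.mono hmem))
  simp only [expGroup_apply_neg_apply, sub_self, expGroup_zero_apply] at hparts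
  rw [map_add, h1, hparts, hv' t ht, hF.2 t ht, hy]
  abel

end BoundedGenerator

/-! ### Maximal dissipative operators, resolvents and Yosida approximation -/

section MaximalDissipative

variable {X : Type*} [NormedAddCommGroup X] [InnerProductSpace ℝ X]

/-- The graph of a maximal dissipative linear operator on a Hilbert space. -/
structure IsMaximalDissipative (Γ : Submodule ℝ (X × X)) : Prop where
  inner_le : ∀ p ∈ Γ, ⟪p.2, p.1⟫_ℝ ≤ 0
  range : ∀ κ : ℝ, 0 < κ → ∀ y : X, ∃ p ∈ Γ, κ • p.1 - p.2 = y
  single : ∀ z : X, ((0 : X), z) ∈ Γ → z = 0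

namespace IsMaximalDissipative

variable {Γ : Submodule ℝ (X × X)}

/-- Membership of `(x, κ(x - y))` encodes `x = (1 - Γ/κ)⁻¹ y`. The difference of two solutions has
slope `κ > 0`, which dissipativity permits only for zero. -/
theorem resolvent_unique (hΓ : IsMaximalDissipative Γ) {κ : ℝ} (hκ : 0 < κ) {x x' y : X}
    (h : (x, κ • (x - y)) ∈ Γ) (h' : (x', κ • (x' - y)) ∈ Γ) : x = x' := by
  have h1 := hΓ.inner_le _ (Γ.sub_mem h h')
  have e : κ • (x - y) - κ • (x' - y) = κ • (x - x') := by rw [← smul_sub]; congr 1; abel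
  simp only [Prod.mk_sub_mk, e, inner_smul_left, real_inner_self_eq_norm_sq] at h1
  have h2 : ‖x - x'‖ ^ 2 ≤ 0 := nonpos_of_mul_nonpos_right h1 (by simpa using hκ)
  exact sub_eq_zero.1 (norm_eq_zero.1 (pow_eq_zero_iff (two_ne_zero)|>.1 (le_antisymm h2 (sq_nonneg _))))

theorem exists_resolvent (hΓ : IsMaximalDissipative Γ) {κ : ℝ} (hκ : 0 < κ) :
    ∃ J : X →L[ℝ] X, ∀ y, (J y, κ • (J y - y)) ∈ Γ ∧ ‖J y‖ ≤ ‖y‖ := by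
  have hex : ∀ y, ∃ x, (x, κ • (x - y)) ∈ Γ := fun y => by
    obtain ⟨p, hp, he⟩ := hΓ.range κ hκ (κ • y)
    refine ⟨p.1, ?_⟩
    have : p.2 = κ • (p.1 - y) := by rw [smul_sub, ← he]; abel
    rwa [← this]
  choose J hJ using hex
  have hbound : ∀ y, ‖J y‖ ≤ ‖y‖ := fun y => by
    have h1 := hΓ.inner_le _ (hJ y)
    simp only [inner_smul_left, inner_sub_left, real_inner_self_eq_norm_sq] at h1
    have h2 : ‖J y‖ ^ 2 - ⟪y, J y⟫_ℝ ≤ 0 := nonpos_of_mul_nonpos_right h1 (by simpa using hκ)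
    have h3 := real_inner_le_norm y (J y)
    by_contra! h4
    nlinarith [norm_nonneg (J y), norm_nonneg y]
  let L : X →ₗ[ℝ] X :=
    { toFun := J
      map_add' := fun y y' => by
        refine hΓ.resolvent_unique hκ (hJ _) ?_
        have := Γ.add_mem (hJ y) (hJ y')
        rw [Prod.mk_add_mk, ← smul_add] at this
        convert this using 3
        abel
      map_smul' := fun a y => by
        refine hΓ.resolvent_unique hκ (hJ _) ?_
        have := Γ.smul_mem a (hJ y)
        rw [Prod.smul_mk, smul_comm, smul_sub] at this
        exact this }
  exact ⟨L.mkContinuous 1 fun y => (hbound y).trans_eq (one_mul _).symm, fun y => ⟨hJ y, hbound y⟩⟩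

/-- A family of resolvents of `Γ` at the points `n + 1`. -/
noncomputable def resolvent (hΓ : IsMaximalDissipative Γ) (n : ℕ) : X →L[ℝ] X :=
  (hΓ.exists_resolvent (κ := (n : ℝ) + 1) (by positivity)).choose

/-- The Yosida approximations of `Γ`. -/
noncomputable def yosida (hΓ : IsMaximalDissipative Γ) (n : ℕ) : X →L[ℝ] X :=
  ((n : ℝ) + 1) • (hΓ.resolvent n - 1)

variable (hΓ : IsMaximalDissipative Γ)

theorem yosida_apply (n : ℕ) (y : X) :
    hΓ.yosida n y = ((n : ℝ) + 1) • (hΓ.resolvent n y - y) := rfl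

theorem resolvent_mem (n : ℕ) (y : X) : (hΓ.resolvent n y, hΓ.yosida n y) ∈ Γ :=
  ((hΓ.exists_resolvent (κ := (n : ℝ) + 1) (by positivity)).choose_spec y).1

theorem norm_resolvent_le (n : ℕ) (y : X) : ‖hΓ.resolvent n y‖ ≤ ‖y‖ :=
  ((hΓ.exists_resolvent (κ := (n : ℝ) + 1) (by positivity)).choose_spec y).2

theorem resolvent_eq (n : ℕ) {x y : X} (h : (x, ((n : ℝ) + 1) • (x - y)) ∈ Γ) :
    hΓ.resolvent n y = x :=
  hΓ.resolvent_unique (by positivity) (hΓ.resolvent_mem n y) h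

/-- The resolvent commutes with the operator on its domain: subtracting the two graph points and
scaling by `n + 1` gives the equation that characterises the resolvent at `z`. -/
theorem resolvent_of_mem (n : ℕ) {x z : X} (h : (x, z) ∈ Γ) :
    hΓ.resolvent n z = hΓ.yosida n x := by
  refine hΓ.resolvent_eq n ?_
  have := Γ.smul_mem ((n : ℝ) + 1) (Γ.sub_mem (hΓ.resolvent_mem n x) h)
  rwa [Prod.mk_sub_mk, Prod.smul_mk] at this

/-- This is the resolvent identity: both `(m - n) J_n J_m y` and `(m - n) J_m J_n y` equal `(m + 1)
J_n y - (n + 1) J_m y`. -/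
theorem commute_resolvent (n m : ℕ) : Commute (hΓ.resolvent n) (hΓ.resolvent m) := by
  rcases eq_or_ne n m with rfl | hnm
  · exact Commute.refl _
  ext y
  have h1 := hΓ.resolvent_of_mem n (hΓ.resolvent_mem m y)
  have h2 := hΓ.resolvent_of_mem m (hΓ.resolvent_mem n y)
  simp only [yosida_apply, map_smul, map_sub] at h1 h2
  simp only [mul_apply_eq_comp]
  have hne : ((m : ℝ) + 1) - ((n : ℝ) + 1) ≠ 0 := by
    rw [add_sub_add_right_eq_sub, sub_ne_zero]; exact_mod_cast hnm.symm
  apply smul_right_injective X hne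
  simp only [sub_smul, smul_sub] at h1 h2 ⊢
  rw [sub_eq_sub_iff_add_eq_add] at h1 h2 ⊢
  have h3 := congrArg₂ (· + ·) h1 h2
  rw [← sub_eq_zero] at h1 h2 ⊢
  have : ∀ a b c d : X, a = 0 → b = 0 → c = a + b → c = 0 := by
    rintro _ _ _ _ rfl rfl h; simpa using h
  refine this _ _ _ 0 h1 h2 ?_
  abel

theorem commute_yosida (n m : ℕ) : Commute (hΓ.yosida n) (hΓ.yosida m) :=
  ((((hΓ.commute_resolvent n m).sub_left (Commute.one_left _)).sub_right
    ((Commute.one_right _))).smul_left _).smul_right _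

theorem inner_yosida_le (n : ℕ) (y : X) : ⟪hΓ.yosida n y, y⟫_ℝ ≤ 0 := by
  rw [yosida_apply, inner_smul_left, inner_sub_left, real_inner_self_eq_norm_sq]
  refine mul_nonpos_of_nonneg_of_nonpos (by simp; positivity) ?_
  have h1 := real_inner_le_norm (hΓ.resolvent n y) y
  have h2 := hΓ.norm_resolvent_le n y
  nlinarith [norm_nonneg y]

theorem norm_resolvent_sub_le (n : ℕ) {x z : X} (h : (x, z) ∈ Γ) :
    ‖hΓ.resolvent n x - x‖ ≤ ‖z‖ / ((n : ℝ) + 1) := by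
  have h1 := hΓ.norm_resolvent_le n z
  rw [hΓ.resolvent_of_mem n h, yosida_apply, norm_smul, Real.norm_of_nonneg (by positivity)] at h1
  rw [le_div_iff₀ (by positivity)]
  linarith

/-- Write a vector `y` orthogonal to the domain as `p.1 - p.2` with `p` in the graph. Then `0 = ⟪y,
p.1⟫ ≥ ‖p.1‖²`, so `p.1 = 0`, and single-valuedness forces `p.2 = 0`. -/
theorem dense_domain [CompleteSpace X] (hΓ : IsMaximalDissipative Γ) :
    Dense (Γ.map (LinearMap.fst ℝ X X) : Set X) := by
  rw [Submodule.dense_iff_topologicalClosure_eq_top, Submodule.topologicalClosure_eq_top_iff,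
    Submodule.eq_bot_iff]
  intro y hy
  obtain ⟨p, hp, he⟩ := hΓ.range 1 one_pos y
  have h0 : ⟪p.1, y⟫_ℝ = 0 := hy _ ⟨p, hp, rfl⟩
  have h1 := hΓ.inner_le p hp
  rw [← he, inner_sub_right, one_smul, real_inner_self_eq_norm_sq, real_inner_comm] at h0
  have hp1 : p.1 = 0 := by
    rw [← norm_eq_zero, ← pow_eq_zero_iff two_ne_zero]
    linarith [sq_nonneg ‖p.1‖]
  have hp2 : p.2 = 0 := hΓ.single _ (by rw [← hp1]; exact hp)
  rw [← he, hp1, hp2]; simp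

/-- A maximal dissipative graph is closed, since a graph point satisfies `x = J (x - z)` with the
continuous resolvent `J` at the point `1` (index `0`). -/
theorem mem_of_tendsto (hΓ : IsMaximalDissipative Γ) {x z : ℕ → X} {x' z' : X}
    (h : ∀ n, (x n, z n) ∈ Γ) (hx : Tendsto x atTop (𝓝 x')) (hz : Tendsto z atTop (𝓝 z')) :
    (x', z') ∈ Γ := by
  have hJ : ∀ n, hΓ.resolvent 0 (x n - z n) = x n := fun n =>
    hΓ.resolvent_eq 0 (by simpa using h n)
  have h1 : Tendsto (fun n => hΓ.resolvent 0 (x n - z n)) atTop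
      (𝓝 (hΓ.resolvent 0 (x' - z'))) := ((hΓ.resolvent 0).continuous.tendsto _).comp (hx.sub hz)
  simp only [hJ] at h1
  have h2 := tendsto_nhds_unique h1 hx
  have h3 := hΓ.resolvent_mem 0 (x' - z')
  rw [yosida_apply, h2] at h3
  simpa using h3

/-- The bounded approximations of the shifted operator `Γ + ρ`. -/
noncomputable def approx (ρ : ℝ) (n : ℕ) : X →L[ℝ] X := hΓ.yosida n + ρ • 1

theorem approx_apply (ρ : ℝ) (n : ℕ) (x : X) : hΓ.approx ρ n x = hΓ.yosida n x + ρ • x := rfl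

/-- The constant does not depend on `n`. Taking `|ρ|` instead of `ρ` makes the resulting growth
factor increasing in time. -/
theorem inner_approx_le (ρ : ℝ) (n : ℕ) (x : X) : ⟪hΓ.approx ρ n x, x⟫_ℝ ≤ |ρ| * ‖x‖ ^ 2 := by
  rw [approx_apply, inner_add_left, inner_smul_left, real_inner_self_eq_norm_sq]
  have h1 := hΓ.inner_yosida_le n x
  have h2 : ρ * ‖x‖ ^ 2 ≤ |ρ| * ‖x‖ ^ 2 := mul_le_mul_of_nonneg_right (le_abs_self ρ) (sq_nonneg _)
  simp only [conj_trivial]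
  linarith

theorem commute_approx (ρ : ℝ) (n m : ℕ) : Commute (hΓ.approx ρ n) (hΓ.approx ρ m) :=
  ((hΓ.commute_yosida n m).add_left ((Commute.one_left _).smul_left _)).add_right
    ((Commute.one_right _).smul_right _)

theorem uniformCauchySeqOn_of_dense {E : ℕ → ℝ → X →L[ℝ] X} {s : Set ℝ} {C : ℝ}
    (hC : ∀ n, ∀ t ∈ s, ∀ x, ‖E n t x‖ ≤ C * ‖x‖) {A : Set X} (hA : Dense A)
    (h : ∀ x ∈ A, UniformCauchySeqOn (fun n t => E n t x) atTop s) (x : X) :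
    UniformCauchySeqOn (fun n t => E n t x) atTop s := by
  rw [Metric.uniformCauchySeqOn_iff]
  intro ε hε
  obtain ⟨x', hx', hx'A⟩ := Metric.dense_iff.1 hA x (ε / (3 * (|C| + 1))) (by positivity)
  obtain ⟨N, hN⟩ := Metric.uniformCauchySeqOn_iff.1 (h x' hx'A) (ε / 3) (by positivity)
  have hC' : ∀ n, ∀ t ∈ s, ‖E n t x - E n t x'‖ ≤ ε / 3 := fun n t ht => by
    rw [← map_sub]
    have h1 : ‖x - x'‖ < ε / (3 * (|C| + 1)) := by
      rw [← dist_eq_norm, dist_comm]; exact hx'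
    calc _ ≤ C * ‖x - x'‖ := hC n t ht _
      _ ≤ (|C| + 1) * ‖x - x'‖ :=
        mul_le_mul_of_nonneg_right (by linarith [le_abs_self C]) (norm_nonneg _)
      _ ≤ (|C| + 1) * (ε / (3 * (|C| + 1))) := mul_le_mul_of_nonneg_left h1.le (by positivity)
      _ = ε / 3 := by field_simp
  refine ⟨N, fun m hm n hn t ht => ?_⟩
  have h1 := hN m hm n hn t ht
  rw [dist_eq_norm] at h1 ⊢
  have e : E m t x - E n t x = (E m t x - E m t x') + (E m t x' - E n t x') -
    (E n t x - E n t x') := by abel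
  rw [e]
  refine (norm_sub_le _ _).trans_lt ?_
  have := norm_add_le (E m t x - E m t x') (E m t x' - E n t x')
  linarith [hC' m t ht, hC' n t ht]

variable [CompleteSpace X]

/-- On the domain the error is `O(1/n)`; density and the contraction property extend the convergence
to the whole space. -/
theorem tendsto_resolvent (x : X) : Tendsto (fun n => hΓ.resolvent n x) atTop (𝓝 x) := by
  rw [Metric.tendsto_atTop]
  intro ε hε
  obtain ⟨x', hx', ⟨p, hp, rfl⟩⟩ := Metric.dense_iff.1 hΓ.dense_domain x (ε / 3) (by positivity)
  obtain ⟨N, hN⟩ := exists_nat_gt (‖p.2‖ / (ε / 3))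
  refine ⟨N, fun n hn => ?_⟩
  have h1 := hΓ.norm_resolvent_sub_le n (x := p.1) (z := p.2) hp
  have h2 : ‖p.2‖ / ((n : ℝ) + 1) < ε / 3 := by
    rw [div_lt_iff₀ (by positivity)] at hN ⊢
    have : (N : ℝ) ≤ n := by exact_mod_cast hn
    nlinarith
  have h3 : ‖p.1 - x‖ < ε / 3 := by simpa [dist_eq_norm] using hx'
  have h4 := hΓ.norm_resolvent_le n (p.1 - x)
  rw [map_sub] at h4
  rw [dist_eq_norm]
  have e : hΓ.resolvent n x - x = -(hΓ.resolvent n p.1 - hΓ.resolvent n x) +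
    (hΓ.resolvent n p.1 - p.1) + (p.1 - x) := by abel
  rw [e]
  refine (norm_add₃_le).trans_lt ?_
  rw [norm_neg]
  linarith

/-- On the domain the Yosida approximation of `x` is the resolvent applied to `z`, which tends to
`z`. -/
theorem tendsto_approx (ρ : ℝ) {x z : X} (h : (x, z) ∈ Γ) :
    Tendsto (fun n => hΓ.approx ρ n x) atTop (𝓝 (z + ρ • x)) := by
  simp only [approx_apply, ← hΓ.resolvent_of_mem _ h]
  exact (hΓ.tendsto_resolvent z).add tendsto_const_nhds

theorem norm_expGroup_approx_le (ρ : ℝ) {T t : ℝ} (ht : t ∈ Icc 0 T) (n : ℕ) (x : X) :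
    ‖expGroup (hΓ.approx ρ n) t x‖ ≤ Real.exp (|ρ| * T) * ‖x‖ := by
  refine (norm_expGroup_apply_le (hΓ.inner_approx_le ρ n) ht.1 x).trans ?_
  refine mul_le_mul_of_nonneg_right (Real.exp_le_exp.2 ?_) (norm_nonneg _)
  exact mul_le_mul_of_nonneg_left ht.2 (abs_nonneg _)

/-- The semigroup generated by `Γ + ρ` is the limit of the groups generated by the
approximations. -/
theorem exists_semigroup (ρ T : ℝ) : ∃ S : ℝ → X → X, ∀ x,
    TendstoUniformlyOn (fun n t => expGroup (hΓ.approx ρ n) t x) (fun t => S t x) atTop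
      (Icc 0 T) := by
  have hcau : ∀ x, UniformCauchySeqOn (fun n t => expGroup (hΓ.approx ρ n) t x) atTop
      (Icc 0 T) := by
    refine uniformCauchySeqOn_of_dense (fun n t ht x => hΓ.norm_expGroup_approx_le ρ ht n x)
      hΓ.dense_domain ?_
    -- On the domain the approximate generators converge, and the difference of their orbits is
    -- controlled by the difference of the generators at `p.1`.
    rintro _ ⟨p, hp, rfl⟩
    rw [Metric.uniformCauchySeqOn_iff]
    intro ε hε
    obtain ⟨N, hN⟩ := Metric.cauchySeq_iff.1 (hΓ.tendsto_approx ρ (x := p.1) (z := p.2) hp).cauchySeq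
      (ε / (Real.exp (|ρ| * T) * (|T| + 1))) (by positivity)
    refine ⟨N, fun m hm n hn t ht => ?_⟩
    have h1 := hN m hm n hn
    rw [dist_eq_norm, lt_div_iff₀ (by positivity)] at h1
    rw [dist_eq_norm]
    refine lt_of_le_of_lt ?_ h1
    refine (norm_expGroup_sub_le (hΓ.inner_approx_le ρ m) (hΓ.inner_approx_le ρ n)
      (hΓ.commute_approx ρ m n) ht.1 p.1).trans ?_
    have h2 : Real.exp (|ρ| * t) ≤ Real.exp (|ρ| * T) :=
      Real.exp_le_exp.2 (mul_le_mul_of_nonneg_left ht.2 (abs_nonneg _))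
    have h3 : t ≤ |T| + 1 := by linarith [ht.2, le_abs_self T]
    calc _ ≤ Real.exp (|ρ| * T) * ‖hΓ.approx ρ m p.1 - hΓ.approx ρ n p.1‖ * (|T| + 1) := by
          gcongr; exact ht.1
      _ = _ := by ring
  have hlim : ∀ t x, ∃ y, t ∈ Icc 0 T →
      Tendsto (fun n => expGroup (hΓ.approx ρ n) t x) atTop (𝓝 y) := fun t x => by
    by_cases ht : t ∈ Icc 0 T
    · obtain ⟨y, hy⟩ := cauchySeq_tendsto_of_complete ((hcau x).cauchySeq ht)
      exact ⟨y, fun _ => hy⟩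
    · exact ⟨0, fun h => (ht h).elim⟩
  choose S hS using hlim
  exact ⟨S, fun x => (hcau x).tendstoUniformlyOn_of_tendsto fun t ht => hS t x ht⟩

end IsMaximalDissipative

end MaximalDissipative

/-! ### The inhomogeneous Cauchy problem -/

section Evolution

variable {X : Type*} [NormedAddCommGroup X] [InnerProductSpace ℝ X]

/-- Convolutions with a strongly convergent family of uniformly bounded operator functions
converge to a continuous function. -/
theorem tendsto_convolution {T C : ℝ} (hT : 0 ≤ T) {E : ℕ → ℝ → X →L[ℝ] X} {S : ℝ → X → X}
    (hEc : ∀ n, Continuous (E n)) (hE : ∀ n, ∀ t ∈ Icc 0 T, ∀ x, ‖E n t x‖ ≤ C * ‖x‖)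
    (hES : ∀ t ∈ Icc 0 T, ∀ x, Tendsto (fun n => E n t x) atTop (𝓝 (S t x)))
    (hS : ∀ x, ContinuousOn (fun t => S t x) (Icc 0 T))
    {G : ℝ → X} (hG : IntervalIntegrable G volume 0 T) :
    (∀ t ∈ Icc 0 T, Tendsto (fun n => ∫ r in (0 : ℝ)..t, E n (t - r) (G r)) atTop
      (𝓝 (∫ r in (0 : ℝ)..t, S (t - r) (G r)))) ∧
    ContinuousOn (fun t => ∫ r in (0 : ℝ)..t, S (t - r) (G r)) (Icc 0 T) := by
  have hGi : IntegrableOn G (Ioc 0 T) := (intervalIntegrable_iff_integrableOn_Ioc_of_le hT).1 hG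
  have hsub : ∀ t ∈ Icc 0 T, ∀ r ∈ Ioc 0 t, t - r ∈ Icc 0 T := fun t ht r hr =>
    ⟨by linarith [hr.2], by linarith [hr.1, ht.2]⟩
  have hEm : ∀ n t, AEStronglyMeasurable (fun r => E n (t - r) (G r))
      (volume.restrict (Ioc 0 T)) := fun n t =>
    (isBoundedBilinearMap_apply (𝕜 := ℝ) (E := X) (F := X)).continuous.comp_aestronglyMeasurable
      (((hEc n).comp (continuous_sub_left t)).aestronglyMeasurable.prodMk
        hGi.aestronglyMeasurable)
  have hSb : ∀ t ∈ Icc 0 T, ∀ x, ‖S t x‖ ≤ C * ‖x‖ := fun t ht x =>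
    le_of_tendsto (hES t ht x).norm (Eventually.of_forall fun n => hE n t ht x)
  have hpt : ∀ t ∈ Icc 0 T, Tendsto (fun n => ∫ r in (0 : ℝ)..t, E n (t - r) (G r)) atTop
      (𝓝 (∫ r in (0 : ℝ)..t, S (t - r) (G r))) := fun t ht => by
    refine intervalIntegral.tendsto_integral_filter_of_dominated_convergence
      (fun r => C * ‖G r‖) ?_ ?_ ((hG.mono_Icc ht).norm.const_mul C) ?_
    · refine Eventually.of_forall fun n => ?_
      rw [uIoc_of_le ht.1]
      exact (hEm n t).mono_set (Ioc_subset_Ioc_right ht.2)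
    · refine Eventually.of_forall fun n => Eventually.of_forall fun r hr => ?_
      rw [uIoc_of_le ht.1] at hr
      exact hE n _ (hsub t ht r hr) _
    · refine Eventually.of_forall fun r hr => ?_
      rw [uIoc_of_le ht.1] at hr
      exact hES _ (hsub t ht r hr) _
  refine ⟨hpt, ?_⟩
  -- The indicator moves the variable upper limit into the integrand, so that dominated convergence
  -- applies over the fixed interval. The integrand may jump in `t` only where `r = t₀`, a null set.
  let k : ℝ → ℝ → X := fun t => (Iic t).indicator fun r => S (t - r) (G r)
  have hk : ∀ t ∈ Icc 0 T, ∫ r in (0 : ℝ)..t, S (t - r) (G r) = ∫ r in Ioc 0 T, k t r :=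
    fun t ht => by
      rw [intervalIntegral.integral_of_le ht.1, integral_indicator measurableSet_Iic,
        Measure.restrict_restrict measurableSet_Iic]
      congr 2
      ext r
      simp only [mem_Ioc, mem_inter_iff, mem_Iic]
      exact ⟨fun h => ⟨h.2, h.1, h.2.trans ht.2⟩, fun h => ⟨h.2.1, h.1⟩⟩
  refine ContinuousOn.congr (f := fun t => ∫ r in Ioc 0 T, k t r) (fun t₀ ht₀ => ?_) hk
  refine continuousWithinAt_of_dominated (bound := fun r => C * ‖G r‖) ?_ ?_
    (hGi.norm.const_mul C) ?_
  · filter_upwards [self_mem_nhdsWithin] with t ht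
    refine aestronglyMeasurable_of_tendsto_ae atTop
      (f := fun n => (Iic t).indicator fun r => E n (t - r) (G r))
      (fun n => (hEm n t).indicator measurableSet_Iic) ?_
    filter_upwards [ae_restrict_mem measurableSet_Ioc] with r hr
    by_cases hrt : r ∈ Iic t
    · simp only [k, indicator_of_mem hrt]
      exact hES _ (hsub t ht r ⟨hr.1, hrt⟩) _
    · simp only [k, indicator_of_notMem hrt]
      exact tendsto_const_nhds
  · filter_upwards [self_mem_nhdsWithin] with t ht
    filter_upwards [ae_restrict_mem measurableSet_Ioc] with r hr
    have hn : 0 ≤ C * ‖G r‖ := (norm_nonneg _).trans (hSb t ht _)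
    by_cases hrt : r ∈ Iic t
    · simp only [k, indicator_of_mem hrt]
      exact hSb _ (hsub t ht r ⟨hr.1, hrt⟩) _
    · simpa only [k, indicator_of_notMem hrt, norm_zero] using hn
  · have hne : ∀ᵐ r : ℝ ∂(volume.restrict (Ioc 0 T)), r ≠ t₀ :=
      ae_restrict_of_ae (by simp [ae_iff])
    filter_upwards [hne, ae_restrict_mem measurableSet_Ioc] with r hr hrT
    rcases lt_or_gt_of_ne hr with h | h
    · have hev : ∀ᶠ t in 𝓝[Icc 0 T] t₀, r < t := mem_nhdsWithin_of_mem_nhds (Ioi_mem_nhds h)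
      have hc : ContinuousWithinAt (fun t => S (t - r) (G r)) (Icc 0 T ∩ Ioi r) t₀ :=
        ContinuousWithinAt.comp (f := fun t => t - r) (x := t₀)
          (hS (G r) (t₀ - r) (hsub t₀ ht₀ r ⟨hrT.1, h.le⟩))
          (continuous_sub_right r).continuousWithinAt
          fun t ht => hsub t ht.1 r ⟨hrT.1, (mem_Ioi.1 ht.2).le⟩
      rw [continuousWithinAt_inter (Ioi_mem_nhds h)] at hc
      refine hc.congr_of_eventuallyEq ?_ ?_
      · filter_upwards [hev] with t ht
        exact indicator_of_mem (mem_Iic.2 ht.le) _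
      · exact indicator_of_mem (mem_Iic.2 h.le) _
    · have hev : ∀ᶠ t in 𝓝[Icc 0 T] t₀, t < r := mem_nhdsWithin_of_mem_nhds (Iio_mem_nhds h)
      refine (continuousWithinAt_const (b := (0 : X))).congr_of_eventuallyEq ?_ ?_
      · filter_upwards [hev] with t ht
        exact indicator_of_notMem (by simpa using ht) _
      · exact indicator_of_notMem (by simpa using h) _

variable [CompleteSpace X]

/-- Classical solvability of the inhomogeneous Cauchy problem for a maximal dissipative operator
with a bounded shift. -/
theorem IsMaximalDissipative.exists_classical_solution {Γ : Submodule ℝ (X × X)}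
    (hΓ : IsMaximalDissipative Γ) (ρ : ℝ) {T : ℝ} (hT : 0 ≤ T) {F G : ℝ → X}
    (hF : IsPrimitiveOn T F G) {u₀ z₀ : X} (hu₀ : (u₀, z₀) ∈ Γ) :
    ∃ u v : ℝ → X, u 0 = u₀ ∧ ContinuousOn v (Icc 0 T) ∧
      (∀ t ∈ Icc 0 T, HasDerivWithinAt u (v t) (Icc 0 T) t) ∧
      ∀ t ∈ Icc 0 T, (u t, v t - ρ • u t - F t) ∈ Γ := by
  obtain ⟨S, hS⟩ := hΓ.exists_semigroup ρ T
  set E : ℕ → ℝ → X →L[ℝ] X := fun n => expGroup (hΓ.approx ρ n) with hEdef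
  have hEc : ∀ n, Continuous (E n) := fun n => continuous_expGroup _
  have hE : ∀ n, ∀ t ∈ Icc 0 T, ∀ x, ‖E n t x‖ ≤ Real.exp (|ρ| * T) * ‖x‖ := fun n t ht x =>
    hΓ.norm_expGroup_approx_le ρ ht n x
  have hES : ∀ t ∈ Icc 0 T, ∀ x, Tendsto (fun n => E n t x) atTop (𝓝 (S t x)) :=
    fun t ht x => (hS x).tendsto_at ht
  have hSc : ∀ x, ContinuousOn (fun t => S t x) (Icc 0 T) := fun x =>
    (hS x).continuousOn (Eventually.of_forall fun n =>
      ((hEc n).clm_apply continuous_const).continuousOn).frequently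
  obtain ⟨hconv, hconvc⟩ := tendsto_convolution hT hEc hE hES hSc hF.1
  -- This is the time derivative of the `n`-th approximate solution at `0`. It converges precisely
  -- because `u₀` lies in the domain.
  let y : ℕ → X := fun n => hΓ.approx ρ n u₀ + F 0
  set y' : X := z₀ + ρ • u₀ + F 0 with hy'
  have hy : Tendsto y atTop (𝓝 y') := (hΓ.tendsto_approx ρ hu₀).add tendsto_const_nhds
  let v : ℕ → ℝ → X := fun n t => E n t (y n) + ∫ r in (0 : ℝ)..t, E n (t - r) (G r)
  let v' : ℝ → X := fun t => S t y' + ∫ r in (0 : ℝ)..t, S (t - r) (G r)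
  let u : ℕ → ℝ → X := fun n t => u₀ + ∫ s in (0 : ℝ)..t, v n s
  let u' : ℝ → X := fun t => u₀ + ∫ s in (0 : ℝ)..t, v' s
  have hvn : ∀ n, ContinuousOn (v n) (Icc 0 T) ∧
      ∀ t ∈ Icc 0 T, v n t = hΓ.approx ρ n (u n t) + F t := fun n =>
    mild_solution_derivative (hΓ.approx ρ n) hF u₀ fun t _ => rfl
  have hv'c : ContinuousOn v' (Icc 0 T) := (hSc y').add hconvc
  have hvt : ∀ t ∈ Icc 0 T, Tendsto (fun n => v n t) atTop (𝓝 (v' t)) := fun t ht => by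
    refine Tendsto.add ?_ (hconv t ht)
    have h1 : Tendsto (fun n => E n t (y n - y')) atTop (𝓝 0) := by
      have h2 : Tendsto (fun n => Real.exp (|ρ| * T) * ‖y n - y'‖) atTop (𝓝 0) := by
        simpa using (tendsto_iff_norm_sub_tendsto_zero.1 hy).const_mul (Real.exp (|ρ| * T))
      exact squeeze_zero_norm (fun n => hE n t ht _) h2
    simpa using h1.add (hES t ht y')
  obtain ⟨Cy, hCy⟩ : ∃ C, ∀ n, ‖y n‖ ≤ C := by
    obtain ⟨C, hC⟩ := (Metric.isBounded_range_of_tendsto y hy).exists_norm_le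
    exact ⟨C, fun n => hC _ (mem_range_self n)⟩
  have hvb : ∀ n, ∀ t ∈ Icc 0 T, ‖v n t‖ ≤ Real.exp (|ρ| * T) * Cy +
      ∫ r in (0 : ℝ)..T, Real.exp (|ρ| * T) * ‖G r‖ := fun n t ht => by
    refine (norm_add_le _ _).trans (add_le_add ?_ ?_)
    · exact (hE n t ht _).trans (mul_le_mul_of_nonneg_left (hCy n) (Real.exp_pos _).le)
    · refine (intervalIntegral.norm_integral_le_of_norm_le ht.1
        (g := fun r => Real.exp (|ρ| * T) * ‖G r‖) (Eventually.of_forall fun r hr => ?_)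
        ((hF.1.mono_Icc ht).norm.const_mul _)).trans ?_
      · exact hE n _ ⟨by linarith [hr.2], by linarith [hr.1, ht.2]⟩ _
      · exact intervalIntegral.integral_mono_interval le_rfl ht.1 ht.2
          (Eventually.of_forall fun r => by positivity) (hF.1.norm.const_mul _)
  have hut : ∀ t ∈ Icc 0 T, Tendsto (fun n => u n t) atTop (𝓝 (u' t)) := fun t ht => by
    refine tendsto_const_nhds.add ?_
    have hmem : ∀ s ∈ uIoc 0 t, s ∈ Icc 0 T := fun s hs => by
      rw [uIoc_of_le ht.1] at hs; exact ⟨hs.1.le, hs.2.trans ht.2⟩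
    refine intervalIntegral.tendsto_integral_filter_of_dominated_convergence
      (fun _ => Real.exp (|ρ| * T) * Cy + ∫ r in (0 : ℝ)..T, Real.exp (|ρ| * T) * ‖G r‖) ?_ ?_
      intervalIntegrable_const ?_
    · exact Eventually.of_forall fun n =>
        ((hvn n).1.mono hmem).aestronglyMeasurable measurableSet_uIoc
    · exact Eventually.of_forall fun n => Eventually.of_forall fun s hs => hvb n s (hmem s hs)
    · exact Eventually.of_forall fun s hs => hvt s (hmem s hs)
  have hu'v' : IsPrimitiveOn T u' v' :=
    ⟨ContinuousOn.intervalIntegrable (by rwa [uIcc_of_le hT]), fun t _ => by simp [u']⟩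
  refine ⟨u', v', by simp [u'], hv'c, fun t ht => hu'v'.hasDerivWithinAt hT hv'c ht,
    fun t ht => ?_⟩
  -- The approximate equation says that the resolvent of `u n t`, paired with this right-hand side,
  -- is a point of the graph; closedness passes it to the limit.
  have hY : ∀ n, hΓ.yosida n (u n t) = v n t - ρ • u n t - F t := fun n => by
    rw [(hvn n).2 t ht, hΓ.approx_apply]; abel
  refine hΓ.mem_of_tendsto (x := fun n => hΓ.resolvent n (u n t))
    (z := fun n => v n t - ρ • u n t - F t) (fun n => hY n ▸ hΓ.resolvent_mem n (u n t)) ?_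
    (((hvt t ht).sub ((hut t ht).const_smul ρ)).sub tendsto_const_nhds)
  have h1 : Tendsto (fun n => hΓ.resolvent n (u n t - u' t)) atTop (𝓝 0) :=
    squeeze_zero_norm (fun n => hΓ.norm_resolvent_le n _)
      (tendsto_iff_norm_sub_tendsto_zero.1 (hut t ht))
  simpa using h1.add (hΓ.tendsto_resolvent (u' t))

end Evolution

/-! ### Elliptic operators and right inverses -/

section Elliptic

/-- With `x = R y` the pairing is `⟪E x, x⟫ ≥ c ‖x‖²`, and `‖y‖ ≤ ‖E‖ ‖x‖`. The `+ 1` keeps the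
denominator positive when `E = 0`. -/
theorem inner_rightInverse_ge {M : Type*} [NormedAddCommGroup M] [InnerProductSpace ℝ M]
    {E R : M →L[ℝ] M} {c : ℝ} (hc : 0 ≤ c)
    (hE : ∀ x, c * ‖x‖ ^ 2 ≤ ⟪E x, x⟫_ℝ) (hR : ∀ y, E (R y) = y) (y : M) :
    c / (‖E‖ ^ 2 + 1) * ‖y‖ ^ 2 ≤ ⟪R y, y⟫_ℝ := by
  have h1 := hE (R y)
  rw [hR, real_inner_comm] at h1
  refine le_trans ?_ h1
  have h2 : ‖y‖ ≤ ‖E‖ * ‖R y‖ := by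
    have := E.le_opNorm (R y); rwa [hR] at this
  have h3 : ‖y‖ ^ 2 ≤ (‖E‖ ^ 2 + 1) * ‖R y‖ ^ 2 := by
    have := pow_le_pow_left₀ (norm_nonneg y) h2 2
    nlinarith [sq_nonneg ‖R y‖]
  calc c / (‖E‖ ^ 2 + 1) * ‖y‖ ^ 2 ≤ c / (‖E‖ ^ 2 + 1) * ((‖E‖ ^ 2 + 1) * ‖R y‖ ^ 2) :=
        mul_le_mul_of_nonneg_left h3 (by positivity)
    _ = c * ‖R y‖ ^ 2 := by field_simp

variable {V M : Type*} [NormedAddCommGroup V] [InnerProductSpace ℝ V] [CompleteSpace V]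
  [NormedAddCommGroup M] [InnerProductSpace ℝ M] [CompleteSpace M]

/-- The lemma of Lax and Milgram for elliptic operators on a Hilbert space. -/
theorem exists_rightInverse_of_elliptic {E : V →L[ℝ] V} {c : ℝ} (hc : 0 < c)
    (hE : ∀ x, c * ‖x‖ ^ 2 ≤ ⟪E x, x⟫_ℝ) : ∃ R : V →L[ℝ] V, ∀ y, E (R y) = y := by
  have hco : IsCoercive ((innerSL ℝ).comp E : V →L[ℝ] V →L[ℝ] ℝ) :=
    ⟨c, hc, fun u => by
      have := hE u
      rw [sq, ← mul_assoc] at this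
      simpa using this⟩
  refine ⟨hco.continuousLinearEquivOfBilin.symm, fun y => ?_⟩
  refine ext_inner_right ℝ fun w => ?_
  have := hco.continuousLinearEquivOfBilin_apply (hco.continuousLinearEquivOfBilin.symm y) w
  rw [ContinuousLinearEquiv.apply_symm_apply] at this
  simpa using this.symm

/-- `C C^*` is elliptic with constant `c²`, and `C^* (C C^*)⁻¹` is a right inverse of `C`. -/
theorem exists_rightInverse_of_adjoint_bounded_below {C : V →L[ℝ] M} {c : ℝ} (hc : 0 < c)
    (hC : ∀ y, c * ‖y‖ ≤ ‖C.adjoint y‖) : ∃ R : M →L[ℝ] V, ∀ y, C (R y) = y := by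
  obtain ⟨R, hR⟩ := exists_rightInverse_of_elliptic (E := C.comp C.adjoint) (c := c ^ 2)
    (by positivity) fun x => by
      rw [ContinuousLinearMap.comp_apply, ← ContinuousLinearMap.adjoint_inner_right,
        real_inner_self_eq_norm_sq, ← mul_pow]
      exact pow_le_pow_left₀ (by positivity) (hC x) 2
  exact ⟨C.adjoint.comp R, hR⟩

end Elliptic

/-! ### The coupled system without constraint -/

section Coupled

variable {V H M : Type*} [NormedAddCommGroup V] [InnerProductSpace ℝ V]
  [NormedAddCommGroup H] [InnerProductSpace ℝ H]
  [NormedAddCommGroup M] [InnerProductSpace ℝ M]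

/-- The graph of the operator
`(j p, m) ↦ (-A j p + K^* m - ρ j p, - K p - D m - ρ m)` on `H × M`, with domain
`{(j p, m) | K^* m ∈ H}`. -/
def coupledGraph (j : V →L[ℝ] H) (A : H →L[ℝ] H) (K : V →L[ℝ] M) (D : M →L[ℝ] M) (ρ : ℝ) :
    Submodule ℝ (WithLp 2 (H × M) × WithLp 2 (H × M)) where
  carrier := {x | ∃ p : V, x.1.fst = j p ∧
    (∀ q, ⟪x.2.fst + A (j p) + ρ • j p, j q⟫_ℝ = ⟪x.1.snd, K q⟫_ℝ) ∧
    x.2.snd = -K p - D x.1.snd - ρ • x.1.snd}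
  zero_mem' := ⟨0, by simp, by simp, by simp⟩
  add_mem' := by
    rintro x y ⟨p, hp, hp1, hp2⟩ ⟨q, hq, hq1, hq2⟩
    refine ⟨p + q, by simp [hp, hq], fun r => ?_, ?_⟩
    · have := congrArg₂ (· + ·) (hp1 r) (hq1 r)
      simp only [← inner_add_left] at this
      simp only [Prod.fst_add, Prod.snd_add, WithLp.add_fst, WithLp.add_snd]
      rw [← this]
      congr 1
      simp only [map_add, smul_add]
      abel
    · simp only [Prod.fst_add, Prod.snd_add, WithLp.add_snd, hp2, hq2, map_add, smul_add]
      abel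
  smul_mem' := by
    rintro a x ⟨p, hp, hp1, hp2⟩
    refine ⟨a • p, by simp [hp], fun r => ?_, ?_⟩
    · simp only [Prod.smul_fst, Prod.smul_snd, WithLp.smul_fst, WithLp.smul_snd]
      rw [inner_smul_left, ← hp1 r, ← inner_smul_left]
      congr 1
      simp only [map_smul, smul_add, smul_comm a ρ]
    · simp only [Prod.smul_fst, Prod.smul_snd, WithLp.smul_snd, hp2, map_smul, smul_sub, smul_neg,
        smul_comm a ρ]

variable [CompleteSpace V] [CompleteSpace H] [CompleteSpace M]

/-- Dissipativity: the two `K` terms cancel and the shift `‖A‖` dominates `A`. Range: with `κ' = κ +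
‖A‖`, the second equation gives `m = (κ' + D)⁻¹ (y₂ - K p)`; the remaining equation for `p` contains
`K^* (κ' + D)⁻¹ K`, which is elliptic on `V` because `K` is bounded below. Single-valuedness uses
that `j` is injective with dense range. -/
theorem isMaximalDissipative_coupledGraph {j : V →L[ℝ] H} (hj : Function.Injective j)
    (hjd : DenseRange j) (A : H →L[ℝ] H) {K : V →L[ℝ] M} {cK : ℝ} (hcK : 0 < cK)
    (hK : ∀ q, cK * ‖q‖ ≤ ‖K q‖) {D : M →L[ℝ] M} (hD : ∀ m, 0 ≤ ⟪D m, m⟫_ℝ) :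
    IsMaximalDissipative (coupledGraph j A K D ‖A‖) where
  inner_le := by
    rintro ⟨x, z⟩ ⟨p, hp, hp1, hp2⟩
    simp only at hp hp1 hp2 ⊢
    have h1 := hp1 p
    have h2 : -(‖A‖ * ‖j p‖ ^ 2) ≤ ⟪A (j p), j p⟫_ℝ := by
      have h3 := abs_le.1 (abs_real_inner_le_norm (A (j p)) (j p))
      have h4 := A.le_opNorm (j p)
      nlinarith [norm_nonneg (j p)]
    have h5 := hD x.snd
    have h6 : 0 ≤ ‖A‖ * ‖x.snd‖ ^ 2 := by positivity
    rw [WithLp.prod_inner_apply]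
    change ⟪z.fst, x.fst⟫_ℝ + ⟪z.snd, x.snd⟫_ℝ ≤ 0
    rw [hp, hp2]
    simp only [inner_add_left, inner_sub_left, inner_neg_left, inner_smul_left,
      real_inner_self_eq_norm_sq, conj_trivial] at h1 ⊢
    rw [real_inner_comm] at h5
    rw [real_inner_comm (x.snd) (D x.snd)]
    rw [real_inner_comm (K p) x.snd] at h1
    linarith
  range := fun κ hκ y => by
    set κ' := κ + ‖A‖ with hκ'
    have hκ'0 : 0 < κ' := by positivity
    set E : M →L[ℝ] M := κ' • 1 + D with hEdef
    have hEa : ∀ m, E m = κ' • m + D m := fun m => rfl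
    have hE : ∀ m, κ' * ‖m‖ ^ 2 ≤ ⟪E m, m⟫_ℝ := fun m => by
      rw [hEa, inner_add_left, inner_smul_left, real_inner_self_eq_norm_sq]
      simpa using hD m
    obtain ⟨R, hR⟩ := exists_rightInverse_of_elliptic hκ'0 hE
    have hRge := inner_rightInverse_ge hκ'0.le hE hR
    set c := κ' / (‖E‖ ^ 2 + 1) with hcdef
    have hc : 0 < c := by positivity
    set L : V →L[ℝ] V := j.adjoint.comp (κ' • j + A.comp j) + K.adjoint.comp (R.comp K) with hL
    have hLi : ∀ p q, ⟪L p, q⟫_ℝ = ⟪κ' • j p + A (j p), j q⟫_ℝ + ⟪R (K p), K q⟫_ℝ := fun p q => by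
      rw [← ContinuousLinearMap.adjoint_inner_left, ← ContinuousLinearMap.adjoint_inner_left,
        ← inner_add_left]; rfl
    have hLc : ∀ p, c * cK ^ 2 * ‖p‖ ^ 2 ≤ ⟪L p, p⟫_ℝ := fun p => by
      rw [hLi]
      have h1 : 0 ≤ ⟪κ' • j p + A (j p), j p⟫_ℝ := by
        have h3 := abs_le.1 (abs_real_inner_le_norm (A (j p)) (j p))
        have h4 := A.le_opNorm (j p)
        rw [inner_add_left, inner_smul_left, real_inner_self_eq_norm_sq, conj_trivial, hκ']
        nlinarith [norm_nonneg (j p), mul_nonneg hκ.le (sq_nonneg ‖j p‖)]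
      have h2 := hRge (K p)
      have h3 : (cK * ‖p‖) ^ 2 ≤ ‖K p‖ ^ 2 := pow_le_pow_left₀ (by positivity) (hK p) 2
      have h4 := mul_le_mul_of_nonneg_left h3 hc.le
      calc _ = c * (cK * ‖p‖) ^ 2 := by ring
        _ ≤ _ := by linarith
    obtain ⟨Q, hQ⟩ := exists_rightInverse_of_elliptic (by positivity) hLc
    set p := Q (j.adjoint y.fst + K.adjoint (R y.snd)) with hp
    set m := R (y.snd - K p) with hm
    have hEm : κ' • m + D m = y.snd - K p := by rw [← hEa, hm, hR]
    have hpq : ∀ q, ⟪κ' • j p + A (j p), j q⟫_ℝ + ⟪R (K p), K q⟫_ℝ =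
        ⟪y.fst, j q⟫_ℝ + ⟪R y.snd, K q⟫_ℝ := fun q => by
      rw [← hLi, hp, hQ, inner_add_left, ContinuousLinearMap.adjoint_inner_left,
        ContinuousLinearMap.adjoint_inner_left]
    let x : WithLp 2 (H × M) := WithLp.toLp 2 (j p, m)
    refine ⟨(x, κ • x - y), ⟨p, rfl, fun q => ?_, ?_⟩, by simp⟩
    · change ⟪κ • j p - y.fst + A (j p) + ‖A‖ • j p, j q⟫_ℝ = ⟪m, K q⟫_ℝ
      have h1 := hpq q
      rw [hm, map_sub, inner_sub_left]
      rw [hκ'] at h1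
      simp only [inner_add_left, inner_sub_left, inner_smul_left, conj_trivial] at h1 ⊢
      linarith
    · change κ • m - y.snd = -K p - D m - ‖A‖ • m
      rw [hκ', add_smul] at hEm
      rw [eq_sub_iff_add_eq] at hEm
      rw [← hEm]; abel
  single := by
    rintro z ⟨p, hp, hp1, hp2⟩
    have hp0 : p = 0 := hj (by rw [map_zero]; exact hp.symm)
    subst hp0
    have hz2 : z.snd = 0 := by simpa using hp2
    have hz1 : z.fst = 0 := by
      refine hjd.eq_zero_of_inner_left ℝ fun q => ?_
      simpa using hp1 q
    exact WithLp.ofLp_injective 2 (Prod.ext hz1 hz2)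

/-- A solution of `p' + A p - K^* m = F`, `ε m' + K p + D m = f` on `[0, T]`. -/
structure IsCoupledSolution (j : V →L[ℝ] H) (A : H →L[ℝ] H) (K : V →L[ℝ] M) (D : M →L[ℝ] M)
    (ε T : ℝ) (F : ℝ → H) (f : ℝ → M) (p : ℝ → V) (p' : ℝ → H) (m m' : ℝ → M) : Prop where
  continuousOn_p : ContinuousOn p (Icc 0 T)
  continuousOn_p' : ContinuousOn p' (Icc 0 T)
  continuousOn_m' : ContinuousOn m' (Icc 0 T)
  hasDeriv_p : ∀ t ∈ Icc 0 T, HasDerivWithinAt (fun t => j (p t)) (p' t) (Icc 0 T) t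
  hasDeriv_m : ∀ t ∈ Icc 0 T, HasDerivWithinAt m (m' t) (Icc 0 T) t
  eq_p : ∀ t ∈ Icc 0 T, ∀ q, ⟪p' t + A (j (p t)), j q⟫_ℝ - ⟪m t, K q⟫_ℝ = ⟪F t, j q⟫_ℝ
  eq_m : ∀ t ∈ Icc 0 T, ε • m' t + K (p t) + D (m t) = f t

theorem exists_coupledSolution_one {j : V →L[ℝ] H} (hj : Function.Injective j)
    (hjd : DenseRange j) (A : H →L[ℝ] H) {K : V →L[ℝ] M} {cK : ℝ} (hcK : 0 < cK)
    (hK : ∀ q, cK * ‖q‖ ≤ ‖K q‖) {D : M →L[ℝ] M} (hD : ∀ m, 0 ≤ ⟪D m, m⟫_ℝ)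
    {T : ℝ} (hT : 0 ≤ T) {F F' : ℝ → H} (hF : IsPrimitiveOn T F F') {f f' : ℝ → M}
    (hf : IsPrimitiveOn T f f') (p₀ : V) (m₀ : M) (h₀ : H)
    (hh₀ : ∀ q, ⟪h₀, j q⟫_ℝ = ⟪m₀, K q⟫_ℝ) :
    ∃ p p' m m', IsCoupledSolution j A K D 1 T F f p p' m m' ∧ p 0 = p₀ ∧ m 0 = m₀ := by
  have hΓ := isMaximalDissipative_coupledGraph hj hjd A hcK hK hD
  set ρ := ‖A‖
  let e := (WithLp.prodContinuousLinearEquiv 2 ℝ H M).symm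
  let i₁ : H →L[ℝ] WithLp 2 (H × M) :=
    (e : H × M →L[ℝ] WithLp 2 (H × M)).comp (ContinuousLinearMap.inl ℝ H M)
  let i₂ : M →L[ℝ] WithLp 2 (H × M) :=
    (e : H × M →L[ℝ] WithLp 2 (H × M)).comp (ContinuousLinearMap.inr ℝ H M)
  let π₁ : WithLp 2 (H × M) →L[ℝ] H := (ContinuousLinearMap.fst ℝ H M).comp
    (WithLp.prodContinuousLinearEquiv 2 ℝ H M : WithLp 2 (H × M) →L[ℝ] H × M)
  let π₂ : WithLp 2 (H × M) →L[ℝ] M := (ContinuousLinearMap.snd ℝ H M).comp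
    (WithLp.prodContinuousLinearEquiv 2 ℝ H M : WithLp 2 (H × M) →L[ℝ] H × M)
  have hFf := (hF.clm i₁).add (hf.clm i₂)
  have hfst : ∀ t, (i₁ (F t) + i₂ (f t)).fst = F t := fun t => add_zero (F t)
  have hsnd : ∀ t, (i₁ (F t) + i₂ (f t)).snd = f t := fun t => zero_add (f t)
  have hinit : (WithLp.toLp 2 (j p₀, m₀), WithLp.toLp 2 (h₀ - A (j p₀) - ρ • j p₀,
      -K p₀ - D m₀ - ρ • m₀)) ∈ coupledGraph j A K D ρ :=
    ⟨p₀, rfl, fun q => by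
      refine Eq.trans ?_ (hh₀ q)
      congr 1
      change h₀ - A (j p₀) - ρ • j p₀ + A (j p₀) + ρ • j p₀ = h₀
      abel, rfl⟩
  obtain ⟨u, v, hu0, hvc, huv, hmem⟩ := hΓ.exists_classical_solution ρ hT hFf hinit
  have hex : ∀ t, ∃ p : V, t ∈ Icc 0 T → π₁ (u t) = j p ∧
      (∀ q, ⟪π₁ (v t) + A (j p) - F t, j q⟫_ℝ = ⟪π₂ (u t), K q⟫_ℝ) ∧
      π₂ (v t) + K p + D (π₂ (u t)) = f t := fun t => by
    by_cases ht : t ∈ Icc 0 T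
    · obtain ⟨p, hp, hp1, hp2⟩ := hmem t ht
      simp only [WithLp.sub_fst, WithLp.sub_snd, WithLp.smul_fst, WithLp.smul_snd, hfst, hsnd,
        hp] at hp1 hp2
      refine ⟨p, fun _ => ⟨hp, fun q => ?_, ?_⟩⟩
      · rw [← show _ = ⟪π₂ (u t), K q⟫_ℝ from hp1 q]
        congr 1
        change (v t).fst + A (j p) - F t = _
        abel
      · change (v t).snd + K p + D (u t).snd = f t
        rw [sub_eq_iff_eq_add, sub_eq_iff_eq_add] at hp2
        rw [hp2]; abel
    · exact ⟨0, fun h => (ht h).elim⟩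
  choose p hp using hex
  have hd1 : ∀ t ∈ Icc 0 T, HasDerivWithinAt (fun t => π₁ (u t)) (π₁ (v t)) (Icc 0 T) t :=
    fun t ht => π₁.hasFDerivAt.comp_hasDerivWithinAt t (huv t ht)
  have hd2 : ∀ t ∈ Icc 0 T, HasDerivWithinAt (fun t => π₂ (u t)) (π₂ (v t)) (Icc 0 T) t :=
    fun t ht => π₂.hasFDerivAt.comp_hasDerivWithinAt t (huv t ht)
  have hc2 : ContinuousOn (fun t => π₂ (v t)) (Icc 0 T) := π₂.continuous.comp_continuousOn hvc
  -- The evolution controls only `j p` in `H`. Continuity in the stronger space `V` comes from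
  -- solving the second equation for `K p` and using the lower bound for `K`.
  have hKc : ContinuousOn (fun t => K (p t)) (Icc 0 T) := by
    refine ContinuousOn.congr (f := fun t => f t - π₂ (v t) - D (π₂ (u t)))
      (((hf.continuousOn hT).sub hc2).sub (D.continuous.comp_continuousOn
        fun t ht => (hd2 t ht).continuousWithinAt)) fun t ht => ?_
    simp only
    rw [← (hp t ht).2.2]; abel
  have hpc : ContinuousOn p (Icc 0 T) := by
    intro t ht
    rw [ContinuousWithinAt, tendsto_iff_norm_sub_tendsto_zero]
    have h1 := (tendsto_iff_norm_sub_tendsto_zero.1 (hKc t ht)).const_mul cK⁻¹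
    rw [mul_zero] at h1
    refine squeeze_zero (fun _ => norm_nonneg _) (fun s => ?_) h1
    have := hK (p s - p t)
    rw [map_sub] at this
    rwa [inv_mul_eq_div, le_div_iff₀ hcK, mul_comm]
  have h0 : (0 : ℝ) ∈ Icc 0 T := left_mem_Icc.2 hT
  refine ⟨p, fun t => π₁ (v t), fun t => π₂ (u t), fun t => π₂ (v t), ⟨hpc,
    π₁.continuous.comp_continuousOn hvc, hc2, fun t ht => ?_, hd2, fun t ht q => ?_,
    fun t ht => ?_⟩, hj ?_, ?_⟩
  · exact (hd1 t ht).congr_of_mem (fun s hs => (hp s hs).1.symm) ht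
  · have := (hp t ht).2.1 q
    rw [inner_sub_left] at this
    linarith
  · rw [one_smul]; exact (hp t ht).2.2
  · rw [← (hp 0 h0).1, hu0]; rfl
  · simp only [hu0]; rfl

/-- The substitution `m ↦ √ε m` reduces to `ε = 1`. It replaces `K` by `K/√ε` in both equations, so
the coupling stays skew, `D` by `D/ε`, and `f` by `f/√ε`. -/
theorem exists_coupledSolution {j : V →L[ℝ] H} (hj : Function.Injective j)
    (hjd : DenseRange j) (A : H →L[ℝ] H) {K : V →L[ℝ] M} {cK : ℝ} (hcK : 0 < cK)
    (hK : ∀ q, cK * ‖q‖ ≤ ‖K q‖) {D : M →L[ℝ] M} (hD : ∀ m, 0 ≤ ⟪D m, m⟫_ℝ)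
    {ε T : ℝ} (hε : 0 < ε) (hT : 0 ≤ T) {F F' : ℝ → H} (hF : IsPrimitiveOn T F F') {f f' : ℝ → M}
    (hf : IsPrimitiveOn T f f') (p₀ : V) (m₀ : M) (h₀ : H)
    (hh₀ : ∀ q, ⟪h₀, j q⟫_ℝ = ⟪m₀, K q⟫_ℝ) :
    ∃ p p' m m', IsCoupledSolution j A K D ε T F f p p' m m' ∧ p 0 = p₀ ∧ m 0 = m₀ := by
  set s := √ε with hs
  have hs0 : 0 < s := Real.sqrt_pos.2 hε
  have hss : s * s = ε := Real.mul_self_sqrt hε.le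
  have hfs := hf.clm (s⁻¹ • ContinuousLinearMap.id ℝ M)
  obtain ⟨p, p', m, m', hsol, hp0, hm0⟩ := exists_coupledSolution_one hj hjd A (K := s⁻¹ • K)
    (cK := s⁻¹ * cK) (by positivity) (fun q => by
      rw [smul_apply, norm_smul, Real.norm_of_nonneg (by positivity), mul_assoc]
      exact mul_le_mul_of_nonneg_left (hK q) (by positivity)) (D := ε⁻¹ • D) (fun m => by
      rw [smul_apply, inner_smul_left]
      exact mul_nonneg (by simpa using hε.le) (hD m)) hT hF hfs p₀ (s • m₀) h₀ (fun q => by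
      rw [hh₀, smul_apply, inner_smul_left, inner_smul_right]
      simp [hs0.ne'])
  refine ⟨p, p', fun t => s⁻¹ • m t, fun t => s⁻¹ • m' t, ⟨hsol.continuousOn_p,
    hsol.continuousOn_p', hsol.continuousOn_m'.const_smul _, hsol.hasDeriv_p,
    fun t ht => (hsol.hasDeriv_m t ht).const_smul _, fun t ht q => ?_, fun t ht => ?_⟩, hp0, ?_⟩
  · rw [← hsol.eq_p t ht q, smul_apply, inner_smul_left, inner_smul_right]; simp
  · have h1 := congrArg (fun x => s • x) (hsol.eq_m t ht)
    simp only [one_smul, smul_add, smul_apply, ContinuousLinearMap.id_apply, smul_smul,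
      mul_inv_cancel₀ hs0.ne'] at h1
    rw [← h1, map_smul, smul_smul, ← hss]
    congr 3 <;> field_simp
  · simp [hm0, smul_smul, hs0.ne']

end Coupled

/-! ### The Riesz isomorphism -/

section Riesz

variable {X : Type*} [NormedAddCommGroup X] [InnerProductSpace ℝ X] [CompleteSpace X]

/-- The inverse of the Riesz isomorphism, as a real-linear map. -/
noncomputable def rieszInv (X : Type*) [NormedAddCommGroup X] [InnerProductSpace ℝ X]
    [CompleteSpace X] : StrongDual ℝ X →L[ℝ] X :=
  LinearMap.mkContinuous
    { toFun := (InnerProductSpace.toDual ℝ X).symm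
      map_add' := map_add _
      map_smul' := fun a φ => by simp } 1
    fun φ => by simp

theorem inner_rieszInv (φ : StrongDual ℝ X) (x : X) : ⟪rieszInv X φ, x⟫_ℝ = φ x :=
  InnerProductSpace.toDual_symm_apply

theorem toDual_rieszInv (φ : StrongDual ℝ X) :
    InnerProductSpace.toDual ℝ X (rieszInv X φ) = φ :=
  (InnerProductSpace.toDual ℝ X).apply_symm_apply φ

theorem rieszInv_injective : Function.Injective (rieszInv X) :=
  (InnerProductSpace.toDual ℝ X).symm.injective

theorem norm_rieszInv (φ : StrongDual ℝ X) : ‖rieszInv X φ‖ = ‖φ‖ :=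
  (InnerProductSpace.toDual ℝ X).symm.norm_map φ

end Riesz

/-! ### The constraint operator and its kernel -/

section Constraint

variable {P Q H : Type*}
  [NormedAddCommGroup P] [InnerProductSpace ℝ P]
  [NormedAddCommGroup Q] [InnerProductSpace ℝ Q]
  [NormedAddCommGroup H] [InnerProductSpace ℝ H]

theorem IsInfSupStable.exists_bound {B : P →L[ℝ] StrongDual ℝ Q} (hB : IsInfSupStable B) :
    ∃ β : ℝ, 0 < β ∧ ∀ μ, β * ‖μ‖ ≤ ‖B.flip μ‖ := by
  obtain ⟨β, hβ, h⟩ := hB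
  refine ⟨β, hβ, fun μ => ?_⟩
  rcases eq_or_ne μ 0 with rfl | hμ
  · simp
  have hμ0 : 0 < ‖μ‖ := norm_pos_iff.2 hμ
  rw [← le_div_iff₀ hμ0]
  -- Nonnegativity of the bound covers an empty index set (`P` trivial), where the real supremum is
  -- `0`.
  refine (h μ hμ).trans (Real.iSup_le (fun q => ?_) (by positivity))
  have hq0 : 0 < ‖(q : P)‖ := norm_pos_iff.2 q.2
  rw [div_le_div_iff₀ (by positivity) hμ0]
  have h1 : B q μ ≤ ‖B.flip μ‖ * ‖(q : P)‖ :=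
    (le_abs_self _).trans ((B.flip μ).le_opNorm q)
  nlinarith

theorem mem_kerP {B : P →L[ℝ] StrongDual ℝ Q} {q : P} : q ∈ kerP B ↔ B q = 0 := Iff.rfl

theorem isClosed_kerP (B : P →L[ℝ] StrongDual ℝ Q) : IsClosed (kerP B : Set P) :=
  B.isClosed_ker

/-- The embedding of `P_ker` into `H_ker`. -/
def kerEmbedding (ι : P →L[ℝ] H) (B : P →L[ℝ] StrongDual ℝ Q) : kerP B →L[ℝ] kerH ι B :=
  (ι.comp (kerP B).subtypeL).codRestrict (kerH ι B) fun q =>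
    Submodule.le_topologicalClosure _ ⟨q, q.2, rfl⟩

theorem denseRange_kerEmbedding (ι : P →L[ℝ] H) (B : P →L[ℝ] StrongDual ℝ Q) :
    DenseRange (kerEmbedding ι B) := by
  intro x
  rw [closure_subtype]
  have : Subtype.val '' range (kerEmbedding ι B) =
      ((kerP B).map (ι : P →ₗ[ℝ] H) : Set H) := by
    ext y
    constructor
    · rintro ⟨_, ⟨q, rfl⟩, rfl⟩
      exact ⟨q, q.2, rfl⟩
    · rintro ⟨q, hq, rfl⟩
      exact ⟨_, ⟨⟨q, hq⟩, rfl⟩, rfl⟩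
  rw [this]
  exact x.2

variable [CompleteSpace P] [CompleteSpace Q]

/-- An inf-sup stable operator has a bounded right inverse `R`; it also recovers the multiplier of
a functional which vanishes on the kernel. -/
theorem IsInfSupStable.exists_rightInverse {B : P →L[ℝ] StrongDual ℝ Q} (hB : IsInfSupStable B) :
    ∃ (R : StrongDual ℝ Q →L[ℝ] P) (Λ : StrongDual ℝ P →L[ℝ] Q), (∀ φ, B (R φ) = φ) ∧
      ∀ φ : StrongDual ℝ P, (∀ q ∈ kerP B, φ q = 0) → B.flip (Λ φ) = φ := by
  obtain ⟨β, hβ, h⟩ := hB.exists_bound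
  set C : P →L[ℝ] Q := (rieszInv Q).comp B with hC
  have hadj : ∀ μ, C.adjoint μ = rieszInv P (B.flip μ) := fun μ => by
    refine ext_inner_right ℝ fun q => ?_
    rw [ContinuousLinearMap.adjoint_inner_left, inner_rieszInv, real_inner_comm, hC,
      ContinuousLinearMap.comp_apply, inner_rieszInv]
    rfl
  obtain ⟨R, hR⟩ := exists_rightInverse_of_adjoint_bounded_below (C := C) hβ fun μ => by
    rw [hadj, norm_rieszInv]; exact h μ
  have hR' : ∀ φ, B (R (rieszInv Q φ)) = φ := fun φ => rieszInv_injective (hR (rieszInv Q φ))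
  refine ⟨R.comp (rieszInv Q), (rieszInv Q).comp
    ((ContinuousLinearMap.compL ℝ Q P ℝ).flip R), hR', fun φ hφ => ?_⟩
  ext q
  -- A functional vanishing on the kernel sees `q` only through `B q`; its multiplier is therefore
  -- the Riesz representative of `φ ∘ R`.
  have h1 : q - R (C q) ∈ kerP B := by
    rw [mem_kerP, map_sub, hC, ContinuousLinearMap.comp_apply, hR', sub_self]
  have h2 : φ q = φ (R (C q)) := by
    rw [← sub_eq_zero, ← map_sub]; exact hφ _ h1
  rw [h2]
  change B q (rieszInv Q (φ.comp R)) = _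
  rw [← inner_rieszInv (B q), real_inner_comm, inner_rieszInv]
  rfl

end Constraint

/-! ### Uniqueness by the energy estimate -/

section Uniqueness

variable {P H M Q : Type*}
  [NormedAddCommGroup P] [InnerProductSpace ℝ P]
  [NormedAddCommGroup H] [InnerProductSpace ℝ H] [CompleteSpace H]
  [NormedAddCommGroup M] [InnerProductSpace ℝ M] [CompleteSpace M]
  [NormedAddCommGroup Q] [InnerProductSpace ℝ Q]

/-- The difference of two solutions lies in `ker B`, so it is an admissible test function that
eliminates the multiplier. The coupling terms cancel, `D` has the right sign, and Gronwall with rate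
`2 ‖A‖` kills the energy. The multipliers then agree because `B^*` is bounded below. -/
theorem IsClassicalSolution.unique {ι : P →L[ℝ] H} (hι : Function.Injective ι)
    {A : H →L[ℝ] StrongDual ℝ H} {K : P →L[ℝ] StrongDual ℝ M}
    {D : M →L[ℝ] StrongDual ℝ M} {B : P →L[ℝ] StrongDual ℝ Q}
    (hD : IsElliptic D) (hB : IsInfSupStable B) {ε T : ℝ} (hε : 0 < ε)
    {f : ℝ → StrongDual ℝ M} {g : ℝ → StrongDual ℝ P} {h : ℝ → StrongDual ℝ Q}
    {p₀ : P} {m₀ : M} {p p' : ℝ → P} {m m' : ℝ → M} {l l' : ℝ → Q}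
    (s : IsClassicalSolution ι A K D B ε T f g h p₀ m₀ p m l)
    (s' : IsClassicalSolution ι A K D B ε T f g h p₀ m₀ p' m' l') :
    EqOn p' p (Icc 0 T) ∧ EqOn m' m (Icc 0 T) ∧ EqOn l' l (Icc 0 T) := by
  obtain ⟨cD, hcD, hD⟩ := hD
  let u : ℝ → H := fun t => ι (p' t) - ι (p t)
  let du : ℝ → H := fun t => derivWithin (fun s => ι (p' s)) (Icc 0 T) t -
    derivWithin (fun s => ι (p s)) (Icc 0 T) t
  let n : ℝ → M := fun t => m' t - m t
  let dn : ℝ → M := fun t => derivWithin m' (Icc 0 T) t - derivWithin m (Icc 0 T) t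
  have hu : ∀ t ∈ Icc 0 T, HasDerivWithinAt u (du t) (Icc 0 T) t := fun t ht =>
    (s'.differentiableOn_p t ht).hasDerivWithinAt.sub (s.differentiableOn_p t ht).hasDerivWithinAt
  have hn : ∀ t ∈ Icc 0 T, HasDerivWithinAt n (dn t) (Icc 0 T) t := fun t ht =>
    (s'.differentiableOn_m t ht).hasDerivWithinAt.sub (s.differentiableOn_m t ht).hasDerivWithinAt
  have hE : ∀ t ∈ Icc 0 T, HasDerivWithinAt (fun t => ‖u t‖ ^ 2 + ε * ‖n t‖ ^ 2)
      (2 * ⟪u t, du t⟫_ℝ + ε * (2 * ⟪n t, dn t⟫_ℝ)) (Icc 0 T) t := fun t ht =>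
    (hu t ht).norm_sq.add ((hn t ht).norm_sq.const_mul ε)
  have henergy : ∀ t ∈ Icc 0 T, 2 * ⟪u t, du t⟫_ℝ + ε * (2 * ⟪n t, dn t⟫_ℝ) ≤
      2 * ‖A‖ * (‖u t‖ ^ 2 + ε * ‖n t‖ ^ 2) := fun t ht => by
    have e1 := DFunLike.congr_fun ((s'.eq_p t ht).trans (s.eq_p t ht).symm) (p' t - p t)
    have e2 := DFunLike.congr_fun ((s'.eq_m t ht).trans (s.eq_m t ht).symm) (n t)
    have e3 : B (p' t - p t) = 0 := by
      rw [map_sub, s'.eq_constraint t ht, s.eq_constraint t ht, sub_self]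
    have hK : K (p' t - p t) (n t) = K (p' t) (n t) - K (p t) (n t) :=
      K.map_sub₂ _ _ _
    have hKn : K (p' t - p t) (n t) = K (p' t - p t) (m' t) - K (p' t - p t) (m t) :=
      map_sub _ _ _
    have hAu : A (u t) (u t) = A (ι (p' t)) (u t) - A (ι (p t)) (u t) :=
      A.map_sub₂ _ _ _
    have hDn : D (n t) (n t) = D (m' t) (n t) - D (m t) (n t) :=
      D.map_sub₂ _ _ _
    have hιu : ι (p' t - p t) = u t := map_sub _ _ _
    have hdu : ⟪u t, du t⟫_ℝ = ⟪derivWithin (fun s => ι (p' s)) (Icc 0 T) t, u t⟫_ℝ -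
        ⟪derivWithin (fun s => ι (p s)) (Icc 0 T) t, u t⟫_ℝ := by
      rw [real_inner_comm, ← inner_sub_left]
    have hdn : ⟪n t, dn t⟫_ℝ = ⟪derivWithin m' (Icc 0 T) t, n t⟫_ℝ -
        ⟪derivWithin m (Icc 0 T) t, n t⟫_ℝ := by
      rw [real_inner_comm, ← inner_sub_left]
    simp only [add_apply, sub_apply, ContinuousLinearMap.comp_apply, smul_apply,
      ContinuousLinearMap.flip_apply, InnerProductSpace.toDual_apply_apply, e3, zero_apply, hιu,
      smul_eq_mul, add_zero] at e1 e2
    have hAb : |A (u t) (u t)| ≤ ‖A‖ * ‖u t‖ ^ 2 := by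
      rw [sq, ← mul_assoc]
      exact A.le_opNorm₂ (u t) (u t)
    have h1 := (abs_le.1 hAb).1
    have h2 : 0 ≤ D (n t) (n t) := le_trans (by positivity) (hD (n t))
    have h3 : 0 ≤ ‖A‖ * (ε * ‖n t‖ ^ 2) := by positivity
    rw [hdu, hdn]
    linarith
  have hzero : ∀ t ∈ Icc 0 T, u t = 0 ∧ n t = 0 := fun t ht => by
    have h1 := le_exp_mul_of_hasDerivWithinAt hE henergy ht
    have h0 : u 0 = 0 ∧ n 0 = 0 := by
      simp [u, n, s.init_p, s'.init_p, s.init_m, s'.init_m]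
    rw [h0.1, h0.2] at h1
    simp only [norm_zero, ne_eq, OfNat.ofNat_ne_zero, not_false_eq_true, zero_pow, mul_zero,
      add_zero] at h1
    have h2 : 0 ≤ ε * ‖n t‖ ^ 2 := by positivity
    have h3 := sq_nonneg ‖u t‖
    refine ⟨norm_eq_zero.1 (pow_eq_zero_iff two_ne_zero |>.1 (by linarith)), ?_⟩
    have h4 : ε * ‖n t‖ ^ 2 = 0 := by linarith
    exact norm_eq_zero.1 (pow_eq_zero_iff two_ne_zero |>.1
      ((mul_eq_zero.1 h4).resolve_left hε.ne'))
  have hp : EqOn p' p (Icc 0 T) := fun t ht => hι (sub_eq_zero.1 (hzero t ht).1)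
  have hm : EqOn m' m (Icc 0 T) := fun t ht => sub_eq_zero.1 (hzero t ht).2
  refine ⟨hp, hm, fun t ht => ?_⟩
  have hιp : EqOn (fun s => ι (p' s)) (fun s => ι (p s)) (Icc 0 T) := fun r hr =>
    congrArg ι (hp hr)
  have e1 := (s'.eq_p t ht).trans (s.eq_p t ht).symm
  rw [derivWithin_congr hιp (hιp ht), hp ht, hm ht] at e1
  have e2 : B.flip (l' t - l t) = 0 := by rw [map_sub, add_left_cancel e1, sub_self]
  obtain ⟨β, hβ, hb⟩ := hB.exists_bound
  have h1 := hb (l' t - l t)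
  rw [e2, norm_zero] at h1
  exact sub_eq_zero.1 (norm_le_zero_iff.1 (nonpos_of_mul_nonpos_right h1 hβ))

end Uniqueness

/-! ### Reduction to the kernel and existence -/

section Existence

variable {P H M Q : Type*}
  [NormedAddCommGroup P] [InnerProductSpace ℝ P] [CompleteSpace P]
  [NormedAddCommGroup H] [InnerProductSpace ℝ H] [CompleteSpace H]
  [NormedAddCommGroup M] [InnerProductSpace ℝ M] [CompleteSpace M]
  [NormedAddCommGroup Q] [InnerProductSpace ℝ Q]

/-- A bounded lifting of functionals on `P` to `M` which inverts `K^*` on the kernel of `B`. -/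
theorem exists_kernel_lift {K : P →L[ℝ] StrongDual ℝ M} {B : P →L[ℝ] StrongDual ℝ Q} {cK : ℝ}
    (hcK : 0 < cK) (hK : ∀ q ∈ kerP B, cK * ‖q‖ ≤ ‖K q‖) :
    ∃ L : StrongDual ℝ P →L[ℝ] M, ∀ φ, ∀ q ∈ kerP B, K q (L φ) = φ q := by
  have : CompleteSpace (kerP B) := (isClosed_kerP B).completeSpace_coe
  set C : kerP B →L[ℝ] M := ((rieszInv M).comp K).comp (kerP B).subtypeL with hC
  -- The lower bound for `K` on the kernel concerns `C = C^{**}`, so it is `C^*` that acquires a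
  -- right inverse.
  obtain ⟨R, hR⟩ := exists_rightInverse_of_adjoint_bounded_below (C := C.adjoint) hcK fun q => by
    rw [ContinuousLinearMap.adjoint_adjoint]
    exact (hK q q.2).trans_eq (norm_rieszInv (K q)).symm
  refine ⟨(R.comp (rieszInv (kerP B))).comp
    ((ContinuousLinearMap.compL ℝ (kerP B) P ℝ).flip (kerP B).subtypeL), fun φ q hq => ?_⟩
  set ψ : StrongDual ℝ (kerP B) := φ.comp (kerP B).subtypeL
  change K q (R (rieszInv (kerP B) ψ)) = ψ ⟨q, hq⟩
  rw [← inner_rieszInv (K q), ← inner_rieszInv ψ, ← hR (rieszInv (kerP B) ψ),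
    ContinuousLinearMap.adjoint_inner_left, hR, real_inner_comm]
  rfl

variable [CompleteSpace Q]

theorem exists_isClassicalSolution {ι : P →L[ℝ] H} (hι : Function.Injective ι)
    (A : H →L[ℝ] StrongDual ℝ H) (K : P →L[ℝ] StrongDual ℝ M)
    {D : M →L[ℝ] StrongDual ℝ M} {B : P →L[ℝ] StrongDual ℝ Q}
    (hD : IsElliptic D) (hB : IsInfSupStable B)
    (hK : ∃ c : ℝ, 0 < c ∧ ∀ q ∈ kerP B, c * ‖q‖ ≤ ‖K q‖)
    {ε T : ℝ} (hε : 0 < ε) (hT : 0 < T)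
    {f f' : ℝ → StrongDual ℝ M} {g₁ g₁' g₁'' : ℝ → StrongDual ℝ P} {g₂ g₂' : ℝ → StrongDual ℝ H}
    {h h' h'' : ℝ → StrongDual ℝ Q}
    (hf : IsPrimitiveOn T f f') (hg₁ : IsPrimitiveOn T g₁ g₁') (hg₁' : IsPrimitiveOn T g₁' g₁'')
    (hg₂ : IsPrimitiveOn T g₂ g₂') (hh : IsPrimitiveOn T h h') (hh' : IsPrimitiveOn T h' h'')
    {p₀ : P} {m₀ : M} (hp₀ : B p₀ = h 0)
    (hcompat : ∃ 𝔥 ∈ kerH ι B, ∀ q ∈ kerP B, ⟪𝔥, ι q⟫_ℝ = (K.flip m₀ + g₁ 0) q) :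
    ∃ (p : ℝ → P) (m : ℝ → M) (l : ℝ → Q),
      IsClassicalSolution ι A K D B ε T f (fun t => g₁ t + (g₂ t).comp ι) h p₀ m₀ p m l ∧
      ContinuousOn p (Icc 0 T) ∧ ContDiffOn ℝ 1 (fun t => ι (p t)) (Icc 0 T) ∧
      ContDiffOn ℝ 1 m (Icc 0 T) ∧ ContinuousOn l (Icc 0 T) := by
  obtain ⟨cD, hcD, hD⟩ := hD
  obtain ⟨cK, hcK, hK⟩ := hK
  obtain ⟨𝔥, h𝔥, hcompat⟩ := hcompat
  have : CompleteSpace (kerP B) := (isClosed_kerP B).completeSpace_coe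
  have : CompleteSpace (kerH ι B) :=
    (Submodule.isClosed_topologicalClosure _).completeSpace_coe
  obtain ⟨R, Λ, hR, hΛ⟩ := hB.exists_rightInverse
  obtain ⟨L, hL⟩ := exists_kernel_lift hcK hK
  let S : kerH ι B →L[ℝ] H := (kerH ι B).subtypeL
  let j := kerEmbedding ι B
  have hSj : ∀ q, S (j q) = ι q := fun q => rfl
  have hj : Function.Injective j := fun a b hab => Subtype.ext (hι (congrArg Subtype.val hab))
  have hSadj : ∀ x q, ⟪S.adjoint x, j q⟫_ℝ = ⟪x, ι q⟫_ℝ := fun x q => by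
    rw [ContinuousLinearMap.adjoint_inner_left, hSj]
  let A' : H →L[ℝ] H := (rieszInv H).comp A
  let K' : P →L[ℝ] M := (rieszInv M).comp K
  let D' : M →L[ℝ] M := (rieszInv M).comp D
  have hK' : ∀ q m, ⟪m, K' q⟫_ℝ = K q m := fun q m => by
    rw [real_inner_comm]; exact inner_rieszInv (K q) m
  let Rh : StrongDual ℝ Q →L[ℝ] H := ι.comp R
  -- Forcings for `p_ker = p - R h` and `n = m + L g₁`: `g₂ - R h' - A R h` projected to `H_ker`,
  -- and `f + ε L g₁' + D L g₁ - K R h`. The term `g₁` itself is absorbed by `K^* L g₁`.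
  have hFP := (((hg₂.clm (rieszInv H)).sub (hh'.clm Rh)).sub (hh.clm (A'.comp Rh))).clm S.adjoint
  have hfP := (((hf.clm (rieszInv M)).add (hg₁'.clm (ε • L))).add (hg₁.clm (D'.comp L))).sub
    (hh.clm (K'.comp R))
  have h0 : (0 : ℝ) ∈ Icc 0 T := left_mem_Icc.2 hT.le
  obtain ⟨p, p', m, m', hsol, hp0, hm0⟩ := exists_coupledSolution hj (denseRange_kerEmbedding ι B)
    (S.adjoint.comp (A'.comp S)) (K := K'.comp (kerP B).subtypeL) hcK
    (fun q => (hK q q.2).trans_eq (norm_rieszInv (K q)).symm) (D := D')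
    (fun m => by
      rw [show ⟪D' m, m⟫_ℝ = D m m from inner_rieszInv (D m) m]
      exact le_trans (by positivity) (hD m)) hε hT.le hFP hfP
    ⟨p₀ - R (h 0), by rw [mem_kerP, map_sub, hp₀, hR, sub_self]⟩ (m₀ + L (g₁ 0)) ⟨𝔥, h𝔥⟩
    -- For the shifted initial value `m₀ + L (g₁ 0)`, the compatibility condition becomes `K^* n(0)
    -- ∈ H_ker`, the domain condition of the generator.
    (fun q => by
      have h1 : ⟪𝔥, ι q⟫_ℝ = K q m₀ + g₁ 0 q := hcompat q q.2
      change ⟪𝔥, ι q⟫_ℝ = ⟪m₀ + L (g₁ 0), K' q⟫_ℝ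
      rw [hK', map_add, hL _ _ q.2, h1])
  have hcp : ContinuousOn (fun t => (p t : P) + R (h t)) (Icc 0 T) :=
    (continuous_subtype_val.comp_continuousOn hsol.continuousOn_p).add
      (R.continuous.comp_continuousOn (hh.continuousOn hT.le))
  have hdp : ∀ t ∈ Icc 0 T, HasDerivWithinAt (fun t => ι ((p t : P) + R (h t)))
      (S (p' t) + Rh (h' t)) (Icc 0 T) t := fun t ht => by
    have h1 := S.hasFDerivAt.comp_hasDerivWithinAt t (hsol.hasDeriv_p t ht)
    have h2 := Rh.hasFDerivAt.comp_hasDerivWithinAt t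
      (hh.hasDerivWithinAt hT.le (hh'.continuousOn hT.le) ht)
    refine (h1.add h2).congr_of_mem (fun s _ => ?_) ht
    rw [map_add]; rfl
  have hdm : ∀ t ∈ Icc 0 T, HasDerivWithinAt (fun t => m t - L (g₁ t)) (m' t - L (g₁' t))
      (Icc 0 T) t := fun t ht =>
    (hsol.hasDeriv_m t ht).sub (L.hasFDerivAt.comp_hasDerivWithinAt t
      (hg₁.hasDerivWithinAt hT.le (hg₁'.continuousOn hT.le) ht))
  have hcp' : ContinuousOn (fun t => S (p' t) + Rh (h' t)) (Icc 0 T) :=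
    (S.continuous.comp_continuousOn hsol.continuousOn_p').add
      (Rh.continuous.comp_continuousOn (hh'.continuousOn hT.le))
  have hcm' : ContinuousOn (fun t => m' t - L (g₁' t)) (Icc 0 T) :=
    hsol.continuousOn_m'.sub (L.continuous.comp_continuousOn (hg₁'.continuousOn hT.le))
  have huniq := uniqueDiffOn_Icc hT
  -- The residual of the first equation without the multiplier; it vanishes on `ker B`, so `Λ`
  -- recovers the multiplier from it continuously in time.
  let φ : ℝ → StrongDual ℝ P := fun t => g₁ t + (g₂ t).comp ι -
    (InnerProductSpace.toDual ℝ H (S (p' t) + Rh (h' t))).comp ι -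
    (A (ι ((p t : P) + R (h t)))).comp ι + K.flip (m t - L (g₁ t))
  have hφc : ContinuousOn φ (Icc 0 T) := by
    refine ((((hg₁.continuousOn hT.le).add ((hg₂.continuousOn hT.le).clm_comp
      continuousOn_const)).sub (ContinuousOn.clm_comp ?_ continuousOn_const)).sub
      (ContinuousOn.clm_comp ?_ continuousOn_const)).add ?_
    · exact (InnerProductSpace.toDual ℝ H).continuous.comp_continuousOn hcp'
    · exact (A.comp ι).continuous.comp_continuousOn hcp
    · exact K.flip.continuous.comp_continuousOn fun t ht => (hdm t ht).continuousWithinAt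
  have hφ : ∀ t ∈ Icc 0 T, ∀ q ∈ kerP B, φ t q = 0 := fun t ht q hq => by
    have h1 := hsol.eq_p t ht ⟨q, hq⟩
    have h2 : ⟪p' t + S.adjoint (A' (S (j (p t)))), j ⟨q, hq⟩⟫_ℝ =
        ⟪S (p' t), ι q⟫_ℝ + A (ι (p t)) (ι q) := by
      rw [inner_add_left, hSadj]
      congr 1
      exact inner_rieszInv (A (ι (p t))) (ι q)
    have h3 : ⟪m t, K' q⟫_ℝ = K q (m t) := hK' q (m t)
    have h4 : ⟪rieszInv H (g₂ t) - Rh (h' t) - A' (Rh (h t)), ι q⟫_ℝ =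
        g₂ t (ι q) - ⟪Rh (h' t), ι q⟫_ℝ - A (Rh (h t)) (ι q) := by
      rw [inner_sub_left, inner_sub_left, inner_rieszInv]
      congr 1
      exact inner_rieszInv (A (Rh (h t))) (ι q)
    have h5 : φ t q = g₁ t q + g₂ t (ι q) - ⟪S (p' t) + Rh (h' t), ι q⟫_ℝ -
        A (ι ((p t : P) + R (h t))) (ι q) + K q (m t - L (g₁ t)) := rfl
    have h6 : A (ι ((p t : P) + R (h t))) (ι q) = A (ι (p t)) (ι q) + A (Rh (h t)) (ι q) := by
      rw [map_add, map_add]; rfl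
    rw [h5, h6, inner_add_left, map_sub, hL _ q hq]
    rw [hSadj] at h1
    have h7 : ⟪p' t + S.adjoint (A' (S (j (p t)))), j ⟨q, hq⟩⟫_ℝ - ⟪m t, K' q⟫_ℝ =
      ⟪rieszInv H (g₂ t) - Rh (h' t) - A' (Rh (h t)), ι q⟫_ℝ := h1
    rw [h2, h3, h4] at h7
    linarith
  refine ⟨fun t => (p t : P) + R (h t), fun t => m t - L (g₁ t), fun t => Λ (φ t), ?_, hcp, ?_, ?_,
    Λ.continuous.comp_continuousOn hφc⟩
  · refine ⟨fun t ht => (hdp t ht).differentiableWithinAt,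
      fun t ht => (hdm t ht).differentiableWithinAt, fun t ht => ?_, fun t ht => ?_,
      fun t ht => ?_, ?_, ?_⟩
    · rw [(hdp t ht).derivWithin (huniq t ht), hΛ _ (hφ t ht)]
      simp only [φ]
      abel
    · rw [(hdm t ht).derivWithin (huniq t ht)]
      have h1 := congrArg (InnerProductSpace.toDual ℝ M) (hsol.eq_m t ht)
      have hK'' : InnerProductSpace.toDual ℝ M (K' (p t)) = K (p t) := toDual_rieszInv _
      have hD'' : ∀ n, InnerProductSpace.toDual ℝ M (D' n) = D n := fun n => toDual_rieszInv _
      have hKR : InnerProductSpace.toDual ℝ M (K' (R (h t))) = K (R (h t)) := toDual_rieszInv _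
      have hεL : (ε • L) (g₁' t) = ε • L (g₁' t) := rfl
      simp only [ContinuousLinearMap.comp_apply, Submodule.subtypeL_apply, map_add, map_sub,
        toDual_rieszInv, hK'', hD'', hKR, hεL, map_smulₛₗ, conj_trivial] at h1
      simp only [map_sub, map_add, smul_sub]
      rw [eq_sub_iff_add_eq] at h1
      rw [← sub_eq_zero] at h1 ⊢
      rw [← h1]
      abel
    · rw [map_add, hR, show B (p t) = 0 from (p t).2, zero_add]
    · simp [hp0]
    · simp [hm0]
  · rw [contDiffOn_one_iff_derivWithin huniq]
    exact ⟨fun t ht => (hdp t ht).differentiableWithinAt,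
      hcp'.congr fun t ht => (hdp t ht).derivWithin (huniq t ht)⟩
  · rw [contDiffOn_one_iff_derivWithin huniq]
    exact ⟨fun t ht => (hdm t ht).differentiableWithinAt,
      hcm'.congr fun t ht => (hdm t ht).derivWithin (huniq t ht)⟩

end Existence

end HyperbolicPDAE

/-! ### The theorem for Sobolev data -/

theorem proposition2p6
    {P H M Q : Type*}
    [NormedAddCommGroup P] [InnerProductSpace ℝ P] [CompleteSpace P]
    [NormedAddCommGroup H] [InnerProductSpace ℝ H] [CompleteSpace H]
    [NormedAddCommGroup M] [InnerProductSpace ℝ M] [CompleteSpace M]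
    [NormedAddCommGroup Q] [InnerProductSpace ℝ Q] [CompleteSpace Q]
    -- the Gelfand triple
    (ι : P →L[ℝ] H) (hι_inj : Function.Injective ι) (hι_dense : DenseRange ι)
    -- the operators
    (A : H →L[ℝ] StrongDual ℝ H) (K : P →L[ℝ] StrongDual ℝ M)
    (D : M →L[ℝ] StrongDual ℝ M) (B : P →L[ℝ] StrongDual ℝ Q)
    (hD : HyperbolicPDAE.IsElliptic D) (hB : HyperbolicPDAE.IsInfSupStable B)
    (hK : ∃ c : ℝ, 0 < c ∧ ∀ q ∈ HyperbolicPDAE.kerP B, c * ‖q‖ ≤ ‖K q‖)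
    (ε T : ℝ) (hε : 0 < ε) (hT : 0 < T)
    -- the right-hand sides
    (f : ℝ → StrongDual ℝ M) (g₁ : ℝ → StrongDual ℝ P) (g₂ : ℝ → StrongDual ℝ H)
    (h : ℝ → StrongDual ℝ Q)
    (hf : HyperbolicPDAE.IsSobolevRepresentative T 1 f)
    (hg₁ : HyperbolicPDAE.IsSobolevRepresentative T 2 g₁)
    (hg₂ : HyperbolicPDAE.IsSobolevRepresentative T 1 g₂)
    (hh : HyperbolicPDAE.IsSobolevRepresentative T 2 h)
    -- the initial data: consistency and compatibility
    (p₀ : P) (m₀ : M) (hp₀ : B p₀ = h 0)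
    (hcompat : ∃ 𝔥 ∈ HyperbolicPDAE.kerH ι B, ∀ q ∈ HyperbolicPDAE.kerP B,
      ⟪𝔥, ι q⟫_ℝ = (K.flip m₀ + g₁ 0) q) :
    ∃ (p : ℝ → P) (m : ℝ → M) (l : ℝ → Q),
      HyperbolicPDAE.IsClassicalSolution ι A K D B ε T f (fun t => g₁ t + (g₂ t).comp ι) h
        p₀ m₀ p m l ∧
      ContinuousOn p (Icc 0 T) ∧ ContDiffOn ℝ 1 (fun t => ι (p t)) (Icc 0 T) ∧
      ContDiffOn ℝ 1 m (Icc 0 T) ∧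
      ContinuousOn l (Icc 0 T) ∧
      ∀ (p' : ℝ → P) (m' : ℝ → M) (l' : ℝ → Q),
        HyperbolicPDAE.IsClassicalSolution ι A K D B ε T f (fun t => g₁ t + (g₂ t).comp ι) h
          p₀ m₀ p' m' l' →
        EqOn p' p (Icc 0 T) ∧ EqOn m' m (Icc 0 T) ∧ EqOn l' l (Icc 0 T) := by
  obtain ⟨f', hf'⟩ := hf.exists_isPrimitiveOn hT
  obtain ⟨g₁', g₁'', hg₁', hg₁''⟩ := hg₁.exists_isPrimitiveOn_two hT
  obtain ⟨g₂', hg₂'⟩ := hg₂.exists_isPrimitiveOn hT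
  obtain ⟨h', h'', hh', hh''⟩ := hh.exists_isPrimitiveOn_two hT
  obtain ⟨p, m, l, hsol, hp, hιp, hm, hl⟩ := HyperbolicPDAE.exists_isClassicalSolution hι_inj A K
    hD hB hK hε hT hf' hg₁' hg₁'' hg₂' hh' hh'' hp₀ hcompat
  exact ⟨p, m, l, hsol, hp, hιp, hm, hl, fun p' m' l' hsol' =>
    hsol.unique hι_inj hD hB hε hsol'⟩
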